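/- For a word $w\in\{0,1\}^*$ let $|w|$ denote its length. A function $f:\{0,1\}^*\to\mathbb N$ is in $\mathsf{\#P}$ if there are a language $B\subseteq\{0,1\}^*\times\{0,1\}^*$ decidable by a Turing machine in polynomial time and a polynomial $p$ such that $(w,u)\in B$ implies $|u|\le p(|w|)$, and $f(w)=\#\{u:(w,u)\in B\}$ for all $w$. A function $f:\{0,1\}^*\to\mathbb Z$ is in $\mathsf{GapP}$ if $f=g-h$ with $g,h\in\mathsf{\#P}$. Partitions and compositions are encoded in unary, as the sequence of their nonzero parts; a family of integers indexed by pairs (word in a given set, partition or composition) is in $\mathsf{GapP}$ if it is the restriction of a $\mathsf{GapP}$ function to the encodings of these pairs. For $n\in\mathbb N$ let $U_n$ be the set of partitions $\lambda=(\lambda_1\ge\dots\ge\lambda_n\ge 0)$, and let $W_n$ be the set of strong compositions (finite sequences of positive integers) with at most $n$ parts. For $\alpha=(\alpha_1,\dots,\alpha_\ell)\in W_n$ let $$M_\alpha=\sum_{1\le i_1<\dots<i_\ell\le n}x_{i_1}^{\alpha_1}\cdots x_{i_\ell}^{\alpha_\ell},\qquad F_\alpha=\sum_{\beta}M_\beta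 ,$$ where the second sum is over the refinements $\beta\in W_n$ of $\alpha$, i.e. those $\beta$ from which $\alpha$ is obtained by adding consecutive parts. Let $s_\lambda=\sum_\mu K_{\lambda\mu}m_\mu$ be the Schur polynomial in $x_1,\dots,x_n$, where $m_\mu$, $\mu\in U_n$, are the monomial symmetric polynomials and $K_{\lambda\mu}$ is the number of semistandard Young tableaux of shape $\lambda$ and content $\mu$. **Theorem.** Let $A\subseteq\{0,1\}^*$ be a set of words (combinatorial objects), let $n:A\to\mathbb N$ be any function (for instance $n(w)=|w|$), and for each $w\in A$ let $G_w\in\mathbb C[x_1,\dots,x_{n(w)}]$ be a symmetric polynomial such that $$G_w=\sum_{\alpha\in W_{n(w)}}c_{w\alpha}\,F_\alpha ,$$ where the sum is finite and the integer coefficients $\{c_{w\alpha}\}$, as a function of $(w,\alpha)$, are in $\mathsf{GapP}$. Then each $G_w$ has a unique expansion $$G_w=\sum_{\lambda\in U_{n(w)}}d_{w\lambda}\,s_\lambda ,$$ with complex coefficients $d_{w\lambda}$, these coefficients are integers, and $\{d_{w\lambda}\}$, as a function of $(w,\lambda)$, are in $\mathsf{GapP}$. The same holds when $\{F_\alpha\}$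 are replaced with $\{M_\alpha\}$. -/

import Mathlib

/-! ### Counting classes over binary words -/

/-- A language of binary words is decidable in polynomial time by a Turing machine. -/
def PolyTimeDecidable (L : Set (List Bool)) : Prop :=
  ∃ χ : List Bool → Bool, (∀ x, χ x = true ↔ x ∈ L) ∧
    Nonempty (Turing.TM2ComputableInPolyTime (id : List Bool → List Bool)
      Computability.encodeBool χ)

/-- The binary word encoding the pair `(u, v)`: every letter of `u` is preceded by a `1`,
a `0` marks the end of `u`, and `v` follows unchanged. -/
def pairWord (u v : List Bool) : List Bool :=
  (u.flatMap fun b => [true, b]) ++ false :: v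

/-- The class `#P`: `f w` is the number of words `u` with `(w, u)` in a fixed polynomial-time
language of pairs, in which the length of `u` is polynomially bounded in the length of `w`. -/
def InSharpP (f : List Bool → ℕ) : Prop :=
  ∃ L : Set (List Bool), PolyTimeDecidable L ∧
    ∃ p : Polynomial ℕ, (∀ w u, pairWord w u ∈ L → u.length ≤ p.eval w.length) ∧
      ∀ w, f w = {u | pairWord w u ∈ L}.ncard

/-- The class `GapP = #P - #P`. -/
def InGapP (f : List Bool → ℤ) : Prop :=
  ∃ g h : List Bool → ℕ, InSharpP g ∧ InSharpP h ∧ ∀ w, f w = (g w : ℤ) - (h w : ℤ)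

/-- Unary encoding of a sequence of natural numbers: the number `a` is written `1 ⋯ 1 0`,
with `a` ones. -/
def unaryWord (l : List ℕ) : List Bool :=
  l.flatMap fun a => List.replicate a true ++ [false]

/-! ### Compositions, partitions and tableaux -/

/-- Strong compositions (of any natural number `k`) into at most `n` parts. -/
abbrev StrongComposition (n : ℕ) : Type :=
  {α : Σ k : ℕ, Composition k // α.2.length ≤ n}

/-- Partitions, as weakly decreasing sequences of `n` nonnegative integers. -/
abbrev PartitionSeq (n : ℕ) : Type :=
  {lam : Fin n → ℕ // Antitone lam}

/-- The unary encoding of a strong composition. -/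
def StrongComposition.word {n : ℕ} (α : StrongComposition n) : List Bool :=
  unaryWord α.1.2.blocks

/-- The unary encoding of a partition. Zero parts are left out, as for compositions, so that
the encoding of a partition does not depend on `n`. -/
def PartitionSeq.word {n : ℕ} (lam : PartitionSeq n) : List Bool :=
  unaryWord ((List.ofFn lam.1).filter fun a => a ≠ 0)

/-- `β` is a refinement of `α`: one obtains `α` by adding consecutive parts of `β`. -/
def Refines {k : ℕ} (β α : Composition k) : Prop :=
  ∃ L : List (List ℕ), L.flatten = β.blocks ∧ L.map List.sum = α.blocks

/-- The Young diagram of a partition. -/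
def PartitionSeq.diagram {n : ℕ} (lam : PartitionSeq n) : YoungDiagram :=
  YoungDiagram.ofRowLens (List.ofFn lam.1) lam.2.sortedGE_ofFn

/-- The Kostka number: the number of semistandard Young tableaux of shape `lam` and content `mu`.
Entries are taken in `{0, …, n - 1}` instead of `{1, …, n}`. -/
noncomputable def kostka {n : ℕ} (lam mu : PartitionSeq n) : ℕ :=
  {T : SemistandardYoungTableau lam.diagram |
    (∀ c ∈ lam.diagram.cells, T c.1 c.2 < n) ∧
    ∀ i : Fin n, (lam.diagram.cells.filter fun c => T c.1 c.2 = (i : ℕ)).card = mu.1 i}.ncard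

/-! ### Polynomials in `n` variables -/

/-- The monomial symmetric polynomial: the sum of `x ^ a` over all different reorderings `a`
of `lam`. -/
noncomputable def monomialSym {n : ℕ} (lam : PartitionSeq n) : MvPolynomial (Fin n) ℂ :=
  ∑ a ∈ Finset.univ.image (fun σ : Equiv.Perm (Fin n) => lam.1 ∘ σ), ∏ i, MvPolynomial.X i ^ a i

open Classical in
/-- The partitions of `k` into at most `n` parts. -/
noncomputable def partitionsOf (n k : ℕ) : Finset (PartitionSeq n) :=
  (Finset.piAntidiag Finset.univ k).subtype Antitone

/-- The Schur polynomial `s_lam`, the sum of `K_{lam, mu} m_mu` over the partitions `mu` of the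
same size as `lam`. -/
noncomputable def schur {n : ℕ} (lam : PartitionSeq n) : MvPolynomial (Fin n) ℂ :=
  ∑ mu ∈ partitionsOf n (∑ i, lam.1 i), (kostka lam mu : ℂ) • monomialSym mu

open Classical in
/-- The monomial quasisymmetric polynomial in `n` variables, the sum of
`x_{i_1} ^ α_1 ⋯ x_{i_ℓ} ^ α_ℓ` over all `i_1 < ⋯ < i_ℓ`. -/
noncomputable def monomialQSym (n : ℕ) {k : ℕ} (α : Composition k) : MvPolynomial (Fin n) ℂ :=
  ∑ i : Fin α.length → Fin n with StrictMono i, ∏ j, MvPolynomial.X (i j) ^ α.blocksFun j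

open Classical in
/-- The fundamental quasisymmetric polynomial in `n` variables: the sum of the monomial
quasisymmetric polynomials of the refinements of `α` with at most `n` parts. -/
noncomputable def fundamentalQSym (n : ℕ) {k : ℕ} (α : Composition k) : MvPolynomial (Fin n) ℂ :=
  ∑ β : Composition k with Refines β α ∧ β.length ≤ n, monomialQSym n β

/-! ### Families of coefficients -/

/-- For words `w ∈ A` and indices in `I w`, encoded by the words `e w i`, the integers `c w i`
are given by a function in `GapP` of the pair `(w, i)`. -/
def CoeffsInGapP (A : Set (List Bool)) {I : List Bool → Type} (e : ∀ w, I w → List Bool)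
    (c : ∀ w, I w →₀ ℤ) : Prop :=
  ∃ f : List Bool → ℤ, InGapP f ∧ ∀ w ∈ A, ∀ i : I w, f (pairWord w (e w i)) = c w i

/-- Every `G w` with `w ∈ A`, a polynomial in `n w` variables, has a unique expansion into Schur
polynomials over `ℂ`; its coefficients are integers, and they are in `GapP`. -/
def SchurCoeffsInGapP (A : Set (List Bool)) (n : List Bool → ℕ)
    (G : ∀ w, MvPolynomial (Fin (n w)) ℂ) : Prop :=
  ∃ d : ∀ w, PartitionSeq (n w) →₀ ℤ,
    (∀ w ∈ A, ∀ d' : PartitionSeq (n w) →₀ ℂ,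
      (G w = d'.sum fun lam a => a • schur lam) ↔
        d' = (d w).mapRange (fun a : ℤ => (a : ℂ)) Int.cast_zero) ∧
    CoeffsInGapP A (fun _ lam => PartitionSeq.word lam) d

/-!
A symmetric polynomial `G` in `n` variables is a combination of Schur polynomials whose
coefficient at `s_λ` is the coefficient of `x ^ (λ + δ)` in the product of `G` with the
Vandermonde product `∏_{i < j} (x_i - x_j)`, where `δ = (n - 1, …, 0)`. Indeed, by the bialternant
formula the product of `s_λ` with the Vandermonde product is the alternant of `λ + δ`; two
alternating polynomials agree if their coefficients at strictly decreasing exponents do. This is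
`eq_sum_schur_iff`. The bialternant formula is proved for the generating function of semistandard
tableaux (`alternant_eq`), by induction on the number of variables: the last variable splits off
from the alternant as the largest entry splits off from a tableau (`alternant_succ`,
`sum_tableaux_succ`). That this generating function is the Schur polynomial defined by Kostka
numbers (`schur_eq`) follows as it is symmetric, being a quotient of two alternating polynomials.

Expanding the Vandermonde product one factor `x_i - x_j` at a time shows that the coefficient is a
signed sum of coefficients of `G`: one starts with `λ`, and for each pair `i < j` either moves a
unit from row `j` to row `i`, with a change of sign, or does nothing. Here the `n - 1 - i` factors
`x_i - x_j` use up the entry `n - 1 - i` of `δ`, so that `δ` disappears when the rows `i` are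
processed from the last to the first. A row that is empty, as are the rows below it, does not
change anything, so that the sum depends only on the nonzero parts of `λ` and not on `n`
(`coeff_vprod_mul`). A coefficient of `G`, in turn, is the coefficient of `M_α` in the expansion
of `G`, where `α` consists of the nonzero exponents, or the sum of the coefficients of `F_α` over
all `α` which arise from the nonzero exponents by merging consecutive parts
(`coeff_sum_quasiSym`). Altogether, the Schur coefficient is a signed sum over the paths in a tree
of binary choices, `coreTree`, of the given coefficients at the compositions at the leaves.

Such sums preserve `GapP` (`inGapP_raise`): a witness for the sum is a path in the tree, followed
by a witness for the coefficient at its leaf. To verify it, one follows the path and passes the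
leaf on to the machine that verifies the second part. For this purpose, programs on stacks of bits
are turned into Turing machines that run a given decider at the end
(`StackProgram.polyTimeDecidable`), and a program that follows paths in `coreTree` is shown to be
correct and to run in quadratic time.
-/

/-! ### Programs on stacks of bits, and their Turing machines -/

/-- A program on stacks of bits indexed by `S`: a label pops one stack, and the popped bit (or
the emptiness of the stack) decides which bits are pushed, and what comes next: another label, a
rejection `none`, or the exit `some i`. -/
structure StackProgram (S ι : Type) where
  /-- the labels -/
  Lab : Type
  /-- the label where the program starts -/
  start : Lab
  /-- the stack popped by a label -/
  scan : Lab → S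
  /-- the bits pushed after the popping, in order, and what comes next -/
  next : Lab → Option Bool → List (S × Bool) × (Lab ⊕ Option ι)

namespace StackProgram

variable {S ι : Type} [DecidableEq S]

/-- Pushing bits onto stacks, in the order of the list. -/
def pushAll (l : List (S × Bool)) (T : S → List Bool) : S → List Bool :=
  l.foldl (fun T p => Function.update T p.1 (p.2 :: T p.1)) T

variable (P : StackProgram S ι)

/-- One step of a program. -/
def next' (q : P.Lab) (T : S → List Bool) : (P.Lab ⊕ Option ι) × (S → List Bool) :=
  ((P.next q (T (P.scan q)).head?).2,
    pushAll (P.next q (T (P.scan q)).head?).1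
      (Function.update T (P.scan q) (T (P.scan q)).tail))

/-- `P.Run n c c'`: the program gets from `c` to `c'` in at most `n` steps. -/
inductive Run : ℕ → (P.Lab ⊕ Option ι) × (S → List Bool) →
    (P.Lab ⊕ Option ι) × (S → List Bool) → Prop
  | refl (n c) : Run n c c
  | step {n q T c} : Run n (P.next' q T) c → Run (n + 1) (Sum.inl q, T) c

variable {P}

theorem Run.mono {n m c c'} (h : P.Run n c c') (hm : n ≤ m) : P.Run m c c' := by
  induction h generalizing m with
  | refl n c => exact .refl _ _
  | step h ih =>
    obtain ⟨m, rfl⟩ : ∃ k, m = k + 1 := ⟨m - 1, by omega⟩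
    exact .step (ih (by omega))

theorem Run.trans {n m c c' c''} (h : P.Run n c c') (h' : P.Run m c' c'') :
    P.Run (n + m) c c'' := by
  induction h with
  | refl n c => exact h'.mono (by omega)
  | step h ih => rw [add_right_comm]; exact .step (ih h')

/-- The total number of bits on the stacks grows by a bounded amount in each step. -/
theorem Run.sum_length_le [Fintype S] {N : ℕ} (hN : ∀ q x, (P.next q x).1.length ≤ N) {n c c'}
    (h : P.Run n c c') : ∑ s, (c'.2 s).length ≤ ∑ s, (c.2 s).length + N * n := by
  have key : ∀ (l : List (S × Bool)) (T : S → List Bool),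
      ∑ s, (pushAll l T s).length = ∑ s, (T s).length + l.length := by
    intro l
    induction l with
    | nil => intro T; simp [pushAll]
    | cons p l ih =>
      intro T
      have := ih (Function.update T p.1 (p.2 :: T p.1))
      rw [pushAll] at this ⊢
      rw [List.foldl_cons, this, ← Finset.add_sum_erase _ _ (Finset.mem_univ p.1),
        ← Finset.add_sum_erase _ (fun s => (T s).length) (Finset.mem_univ p.1),
        Finset.sum_congr rfl (g := fun s => (T s).length)]
      · simp; ring
      · intro s hs
        simp [Function.update_of_ne (Finset.ne_of_mem_erase hs)]
  induction h with
  | refl n c => omega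
  | @step n q T c h ih =>
    refine ih.trans ?_
    rw [next', key]
    have h1 : ∑ s, (Function.update T (P.scan q) (T (P.scan q)).tail s).length ≤
        ∑ s, (T s).length := by
      refine Finset.sum_le_sum fun s _ => ?_
      by_cases hs : s = P.scan q
      · subst hs; simp
      · simp [hs]
    have := hN q (T (P.scan q)).head?
    simp only
    rw [mul_add]
    omega

theorem _root_.Polynomial.eval_mono_nat (p : Polynomial ℕ) : Monotone fun n => p.eval n := by
  intro a b h
  induction p using Polynomial.induction_on' with
  | add p q hp hq => simpa using add_le_add hp hq
  | monomial n a => simpa using Nat.mul_le_mul_left _ (Nat.pow_le_pow_left h n)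

/-! ### Composing a program with deciders -/

open Turing Turing.TM2

section Machine

variable [DecidableEq ι] (P) (inp out : S) (M : ι → FinTM2)
  (e : ∀ i, (M i).Γ (M i).k₀ ≃ Bool) (o : ∀ i, (M i).Γ (M i).k₁ ≃ Bool)

/-- Stacks of the composite machine: those of the program and those of all the machines. -/
abbrev CompositeStack : Type := S ⊕ Σ i, (M i).K

/-- Alphabets of the composite machine. -/
abbrev CompositeAlphabet : CompositeStack (S := S) M → Type
  | Sum.inl _ => Bool
  | Sum.inr p => (M p.1).Γ p.2

/-- Labels of the composite machine: those of the program, a label for copying the stack `out`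
to the input of the `i`-th machine, the labels of the machines, and a label for copying the output
of the `i`-th machine. -/
abbrev CompositeLabel : Type := P.Lab ⊕ ι ⊕ (Σ i, (M i).Λ) ⊕ ι

/-- States of the composite machine: the bit popped last, and the states of all the machines. -/
abbrev CompositeState : Type := Option Bool × ∀ i, (M i).σ

/-- Statements of the composite machine. -/
abbrev CompositeStmt : Type :=
  Stmt (CompositeAlphabet (S := S) M) (CompositeLabel P M) (CompositeState M)

/-- Pushing bits in a statement. -/
def pushStmt (l : List (S × Bool)) (s : CompositeStmt P M) : CompositeStmt P M :=
  l.foldr (fun p s => Stmt.push (Sum.inl p.1) (fun _ => p.2) s) s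

/-- The jump at the end of a step of the program. A rejection writes the answer `false`. -/
def jumpStmt : P.Lab ⊕ Option ι → CompositeStmt P M
  | Sum.inl q => Stmt.goto fun _ => Sum.inl q
  | Sum.inr (some i) => Stmt.goto fun _ => Sum.inr (Sum.inl i)
  | Sum.inr none => Stmt.load (fun v => (none, v.2)) (Stmt.push (Sum.inl inp) (fun _ => false)
      Stmt.halt)

/-- What a label of the program does once the popped value `x` is known. -/
def bodyStmt (q : P.Lab) (x : Option Bool) : CompositeStmt P M :=
  pushStmt P M (P.next q x).1 (jumpStmt P inp M (P.next q x).2)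

/-- A statement of the `i`-th machine as a statement of the composite machine. -/
def liftStmt (i : ι) : Stmt (M i).Γ (M i).Λ (M i).σ → CompositeStmt P M
  | Stmt.push k f s => Stmt.push (Sum.inr ⟨i, k⟩) (fun v => f (v.2 i)) (liftStmt i s)
  | Stmt.peek k f s => Stmt.peek (Sum.inr ⟨i, k⟩)
      (fun v x => (v.1, Function.update v.2 i (f (v.2 i) x))) (liftStmt i s)
  | Stmt.pop k f s => Stmt.pop (Sum.inr ⟨i, k⟩)
      (fun v x => (v.1, Function.update v.2 i (f (v.2 i) x))) (liftStmt i s)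
  | Stmt.load f s => Stmt.load (fun v => (v.1, Function.update v.2 i (f (v.2 i)))) (liftStmt i s)
  | Stmt.branch f s t => Stmt.branch (fun v => f (v.2 i)) (liftStmt i s) (liftStmt i t)
  | Stmt.goto f => Stmt.goto fun v => Sum.inr (Sum.inr (Sum.inl ⟨i, f (v.2 i)⟩))
  | Stmt.halt => Stmt.goto fun _ => Sum.inr (Sum.inr (Sum.inr i))

/-- The statements of the composite machine. -/
def machineStmt : CompositeLabel P M → CompositeStmt P M
  | Sum.inl q => Stmt.pop (Sum.inl (P.scan q)) (fun v x => (x, v.2))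
      (Stmt.branch (fun v => v.1 == none) (bodyStmt P inp M q none)
        (Stmt.branch (fun v => v.1 == some true) (bodyStmt P inp M q (some true))
          (bodyStmt P inp M q (some false))))
  | Sum.inr (Sum.inl i) => Stmt.pop (Sum.inl out) (fun v x => (x, v.2))
      (Stmt.branch (fun v => v.1 == none)
        (Stmt.goto fun _ => Sum.inr (Sum.inr (Sum.inl ⟨i, (M i).main⟩)))
        (Stmt.push (Sum.inr ⟨i, (M i).k₀⟩) (fun v => (e i).symm (v.1.getD false))
          (Stmt.goto fun _ => Sum.inr (Sum.inl i))))
  | Sum.inr (Sum.inr (Sum.inl q)) => liftStmt P M q.1 ((M q.1).m q.2)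
  | Sum.inr (Sum.inr (Sum.inr i)) => Stmt.pop (Sum.inr ⟨i, (M i).k₁⟩)
      (fun v x => (x.map (o i), v.2))
      (Stmt.push (Sum.inl inp) (fun v => v.1.getD false)
        (Stmt.load (fun v => (none, v.2)) Stmt.halt))

/-- The states of all the machines at their start. -/
abbrev vinit : ∀ i, (M i).σ := fun i => (M i).initialState

/-- The composite machine: it runs the program, and on the exit `some i` it runs the `i`-th machine
on the word which the program left, reversed, on the stack `out`. -/
def machine [Fintype S] [Fintype ι] [Fintype P.Lab] : FinTM2 :=
  letI := fun i => (M i).kFin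
  letI := fun i => (M i).ΛFin
  letI := fun i => (M i).σFin
  { K := CompositeStack (S := S) M
    kDecidableEq := inferInstance
    kFin := inferInstance
    k₀ := Sum.inl inp
    k₁ := Sum.inl inp
    Γ := CompositeAlphabet M
    Λ := CompositeLabel P M
    main := Sum.inl P.start
    ΛFin := inferInstance
    σ := CompositeState M
    initialState := (none, vinit M)
    σFin := inferInstance
    Γk₀Fin := inferInstanceAs (Fintype Bool)
    m := machineStmt P inp out M e o }

/-- Contents of the stacks of the composite machine, when only those of the program and those of
the `i`-th machine are used. -/
def joint (T : S → List Bool) (i : ι) (U : ∀ k, List ((M i).Γ k)) :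
    ∀ k : CompositeStack (S := S) M, List (CompositeAlphabet M k)
  | Sum.inl s => T s
  | Sum.inr p => Function.update (β := fun j => ∀ k, List ((M j).Γ k)) (fun _ _ => []) i U p.1 p.2

variable {P inp out M e o}

omit [DecidableEq S] in
@[simp] theorem joint_inl (T : S → List Bool) (i : ι) (U : ∀ k, List ((M i).Γ k)) (s : S) :
    joint M T i U (Sum.inl s) = T s := rfl

omit [DecidableEq S] in
@[simp] theorem joint_inr (T : S → List Bool) (i : ι) (U : ∀ k, List ((M i).Γ k)) (k) :
    joint M T i U (Sum.inr ⟨i, k⟩) = U k := by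
  simp [joint]

@[simp] theorem update_joint_inl (T : S → List Bool) (i : ι) (U : ∀ k, List ((M i).Γ k)) (s : S)
    (x : List Bool) :
    (Function.update (joint M T i U) (Sum.inl s) x) =
      joint M (Function.update T s x) i U := by
  funext k
  rcases k with t | p
  · by_cases h : t = s
    · subst h; simp
    · simp [h]
  · rw [Function.update_of_ne (by simp)]; rfl

@[simp] theorem update_joint_inr (T : S → List Bool) (i : ι) (U : ∀ k, List ((M i).Γ k)) (k)
    (x : List ((M i).Γ k)) :
    (Function.update (joint M T i U) (Sum.inr ⟨i, k⟩) x) =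
      joint M T i (Function.update U k x) := by
  funext k'
  rcases k' with t | ⟨j, k'⟩
  · rw [Function.update_of_ne (by simp)]; rfl
  · by_cases h : j = i
    · subst h
      by_cases h : k' = k
      · subst h; simp
      · rw [Function.update_of_ne (by simpa using h)]; simp [h]
    · rw [Function.update_of_ne (by intro hh; exact h (Sigma.mk.inj (Sum.inr.inj hh)).1)]
      simp [joint, h]

omit [DecidableEq S] in
theorem joint_nil (T : S → List Bool) (i j : ι) :
    joint M T i (fun _ => []) = joint M T j (fun _ => []) := by
  have : ∀ i, Function.update (β := fun j => ∀ k, List ((M j).Γ k)) (fun _ _ => []) i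
    (fun _ => []) = fun _ _ => [] := fun i => Function.update_eq_self i _
  funext k
  rcases k with t | ⟨j, k'⟩
  · rfl
  · simp only [joint, this]

theorem stepAux_pushStmt (l : List (S × Bool)) (s : CompositeStmt P M) (v : CompositeState M)
    (T : S → List Bool) (i : ι) (U) : stepAux (pushStmt P M l s) v (joint M T i U) =
      stepAux s v (joint M (pushAll l T) i U) := by
  induction l generalizing T with
  | nil => rfl
  | cons p l ih =>
    simp only [pushStmt, List.foldr_cons, stepAux, joint_inl]
    rw [update_joint_inl]
    exact ih _

/-- The configuration of the composite machine during a run of the program, until it rejects. -/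
def progCfg (i : ι) (x : Option Bool) (c : (P.Lab ⊕ Option ι) × (S → List Bool)) :
    Cfg (CompositeAlphabet (S := S) M) (CompositeLabel P M) (CompositeState M) :=
  match c with
  | (Sum.inl q, T) => ⟨some (Sum.inl q), (x, vinit M), joint M T i fun _ => []⟩
  | (Sum.inr (some j), T) => ⟨some (Sum.inr (Sum.inl j)), (x, vinit M), joint M T i fun _ => []⟩
  | (Sum.inr none, T) => ⟨none, (none, vinit M),
      joint M (Function.update T inp (false :: T inp)) i fun _ => []⟩

/-- One step of the program is one step of the composite machine. -/
theorem step_progCfg (i : ι) (x : Option Bool) (q : P.Lab) (T : S → List Bool) :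
    ∃ x', TM2.step (machineStmt P inp out M e o) (progCfg (inp := inp) i x (Sum.inl q, T)) =
      some (progCfg (inp := inp) i x' (P.next' q T)) := by
  have key : ∀ (x : Option Bool) T', stepAux (bodyStmt P inp M q x) (x, vinit M)
      (joint M T' i fun _ => []) =
      progCfg (inp := inp) i x ((P.next q x).2, pushAll (P.next q x).1 T') := by
    intro x T'
    rw [bodyStmt, stepAux_pushStmt]
    rcases (P.next q x).2 with q' | _ | j <;> simp [jumpStmt, progCfg]
  refine ⟨(T (P.scan q)).head?, ?_⟩
  rw [show progCfg (inp := inp) i x (Sum.inl q, T) =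
    ⟨some (Sum.inl q), (x, vinit M), joint M T i fun _ => []⟩ from rfl]
  simp only [TM2.step, machineStmt, stepAux, joint_inl]
  rw [update_joint_inl, next']
  rcases h : (T (P.scan q)).head? with _ | _ | _ <;> simpa [h] using key _ _

/-- The configuration of the composite machine during a run of the `i`-th machine. -/
def subCfg (i : ι) (c : Cfg (M i).Γ (M i).Λ (M i).σ) :
    Cfg (CompositeAlphabet (S := S) M) (CompositeLabel P M) (CompositeState M) :=
  ⟨some (c.l.elim (Sum.inr (Sum.inr (Sum.inr i))) fun q => Sum.inr (Sum.inr (Sum.inl ⟨i, q⟩))),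
    (none, Function.update (vinit M) i c.var), joint M (fun _ => []) i c.stk⟩

theorem stepAux_liftStmt (i : ι) (s : Stmt (M i).Γ (M i).Λ (M i).σ) (v : (M i).σ) (U) :
    stepAux (liftStmt P M i s) (none, Function.update (vinit M) i v)
      (joint M (fun _ => []) i U) = subCfg (P := P) i (stepAux s v U) := by
  induction s generalizing v U with
  | push k f s ih =>
    simp only [liftStmt, stepAux, Function.update_self, joint_inr]
    rw [← ih, update_joint_inr]
  | peek k f s ih => simp [liftStmt, stepAux, ih]
  | pop k f s ih =>
    simp only [liftStmt, stepAux, Function.update_self, joint_inr, Function.update_idem]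
    rw [← ih, update_joint_inr]
  | load f s ih => simp [liftStmt, stepAux, ih]
  | branch f s t ihs iht =>
    simp only [liftStmt, stepAux, Function.update_self]
    cases f v <;> simp [ihs, iht]
  | goto f => simp [liftStmt, stepAux, subCfg]
  | halt => simp [liftStmt, stepAux, subCfg]

theorem step_subCfg (i : ι) (c c' : Cfg (M i).Γ (M i).Λ (M i).σ)
    (h : TM2.step (M i).m c = some c') :
    TM2.step (machineStmt P inp out M e o) (subCfg i c) = some (subCfg i c') := by
  rcases c with ⟨_ | q, v, U⟩
  · simp [TM2.step] at h
  · simp only [TM2.step, Option.some.injEq] at h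
    subst h
    exact congrArg some (stepAux_liftStmt i _ v U)

open StateTransition

theorem evals_trans {σ : Type*} {f : σ → Option σ} {a b : σ} {c : Option σ} {m n : ℕ}
    (h : Nonempty (EvalsToInTime f a (some b) m)) (h' : Nonempty (EvalsToInTime f b c n)) :
    Nonempty (EvalsToInTime f a c (m + n)) :=
  add_comm n m ▸ ⟨EvalsToInTime.trans f m n a b c h.some h'.some⟩

theorem evals_step {σ : Type*} {f : σ → Option σ} {a b : σ} (h : f a = some b) :
    Nonempty (EvalsToInTime f a (some b) 1) :=
  ⟨⟨⟨1, h⟩, le_rfl⟩⟩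

theorem evals_mono {σ : Type*} {f : σ → Option σ} {a : σ} {b : Option σ} {m n : ℕ}
    (h : Nonempty (EvalsToInTime f a b m)) (hm : m ≤ n) : Nonempty (EvalsToInTime f a b n) :=
  ⟨⟨h.some.toEvalsTo, h.some.steps_le_m.trans hm⟩⟩

/-- The composite machine simulates a run of the program step by step. -/
theorem evals_prog (i : ι) {n c c'} (h : P.Run n c c') (x : Option Bool) : ∃ x', Nonempty
    (EvalsToInTime (TM2.step (machineStmt P inp out M e o)) (progCfg (inp := inp) i x c)
      (some (progCfg (inp := inp) i x' c')) n) := by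
  induction h generalizing x with
  | refl n c => exact ⟨x, evals_mono ⟨EvalsToInTime.refl _ _⟩ n.zero_le⟩
  | @step n q T c h ih =>
    obtain ⟨x', hx⟩ := step_progCfg (inp := inp) (out := out) (e := e) (o := o) i x q T
    obtain ⟨x'', hx'⟩ := ih x'
    exact ⟨x'', add_comm 1 n ▸ evals_trans (evals_step hx) hx'⟩

/-- The composite machine moves the word on the stack `out` to the input stack of the `i`-th
machine. This reverses the word. -/
theorem evals_feed (i : ι) (x : Option Bool) (z : List Bool) (l : List ((M i).Γ (M i).k₀)) :
    Nonempty (EvalsToInTime (TM2.step (machineStmt P inp out M e o))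
      ⟨some (Sum.inr (Sum.inl i)), (x, vinit M), joint M (Function.update (fun _ => []) out z) i
        (Function.update (fun _ => []) (M i).k₀ l)⟩
      (some ⟨some (Sum.inr (Sum.inr (Sum.inl ⟨i, (M i).main⟩))), (none, vinit M),
        joint M (fun _ => []) i (Function.update (fun _ => []) (M i).k₀
          (z.reverse.map (e i).symm ++ l))⟩) (z.length + 1)) := by
  induction z generalizing x l with
  | nil =>
    refine evals_step (congrArg some ?_)
    simp only [machineStmt, stepAux, joint_inl]
    rw [update_joint_inl]
    simp
  | cons b z ih =>
    have h := ih (some b) ((e i).symm b :: l)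
    rw [List.length_cons, add_comm _ 1, List.reverse_cons, List.map_append, List.append_assoc]
    refine evals_trans (evals_step (congrArg some ?_)) h
    simp only [machineStmt, stepAux, joint_inl]
    rw [update_joint_inl]
    simp only [Function.update_self, joint_inr]
    rw [update_joint_inr]
    simp

/-- The composite machine simulates the `i`-th machine step by step. -/
theorem evals_sub (i : ι) {n : ℕ} {c c' : Cfg (M i).Γ (M i).Λ (M i).σ}
    (h : EvalsToInTime (TM2.step (M i).m) c (some c') n) :
    Nonempty (EvalsToInTime (TM2.step (machineStmt P inp out M e o)) (subCfg i c)
      (some (subCfg i c')) n) := by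
  obtain ⟨⟨m, hm⟩, hmn⟩ := h
  refine evals_mono (m := m) ?_ hmn
  clear hmn
  induction m generalizing c with
  | zero => cases hm; exact ⟨EvalsToInTime.refl _ _⟩
  | succ m ih =>
    rw [Function.iterate_succ_apply] at hm
    change (flip bind (TM2.step (M i).m))^[m] (TM2.step (M i).m c) = some c' at hm
    rcases hc : TM2.step (M i).m c with _ | d
    · rw [hc] at hm
      have : ∀ m, (flip bind (TM2.step (M i).m))^[m] none = none := fun m =>
        Function.iterate_fixed rfl m
      exact absurd ((this m).symm.trans hm) (by simp)
    · rw [hc] at hm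
      exact add_comm 1 m ▸ evals_trans (evals_step (step_subCfg i c d hc)) (ih hm)

theorem initList_eq (tm : FinTM2) (l : List (tm.Γ tm.k₀)) :
    initList tm l = ⟨some tm.main, tm.initialState, Function.update (fun _ => []) tm.k₀ l⟩ := by
  unfold initList
  congr 1
  funext k
  by_cases h : k = tm.k₀
  · subst h; simp
  · simp [h]

theorem haltList_eq (tm : FinTM2) (l : List (tm.Γ tm.k₁)) :
    haltList tm l = ⟨none, tm.initialState, Function.update (fun _ => []) tm.k₁ l⟩ := by
  unfold haltList
  congr 1
  funext k
  by_cases h : k = tm.k₁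
  · subst h; simp
  · simp [h]

/-- The composite machine copies the one-letter answer of the `i`-th machine to its own output
stack, which is the stack `inp`. -/
theorem evals_finish (i : ι) (b : Bool) :
    Nonempty (EvalsToInTime (TM2.step (machineStmt P inp out M e o))
      (subCfg i (haltList (M i) [(o i).symm b]))
      (some ⟨none, (none, vinit M), joint M (Function.update (fun _ => []) inp [b]) i
        fun _ => []⟩) 1) := by
  refine evals_step (congrArg some ?_)
  rw [haltList_eq]
  simp only [machineStmt, stepAux, Option.elim, joint_inr]
  rw [update_joint_inr]
  simp only [joint_inl]
  rw [update_joint_inl]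
  simp [Function.update_eq_self]

end Machine

open Polynomial StateTransition in
/-- A polynomial-time program whose exits are polynomial-time decision problems decides in
polynomial time: on the exit `some i`, the word left on the stack `out` (in reversed order) is
passed to the decision problem `L i`. -/
theorem polyTimeDecidable [Fintype S] [Fintype ι] [Fintype P.Lab] {N : ℕ}
    (hN : ∀ q x, (P.next q x).1.length ≤ N) (i₀ : ι) (inp out : S) {L : ι → Set (List Bool)}
    (hL : ∀ i, PolyTimeDecidable (L i)) (p : Polynomial ℕ) (L' : Set (List Bool))
    (hrej : ∀ x, x ∉ L' → P.Run (p.eval x.length)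
      (Sum.inl P.start, Function.update (fun _ => []) inp x) (Sum.inr none, fun _ => []) ∨
      ∃ i y, y ∉ L i ∧ P.Run (p.eval x.length)
        (Sum.inl P.start, Function.update (fun _ => []) inp x)
        (Sum.inr (some i), Function.update (fun _ => []) out y.reverse))
    (hacc : ∀ x ∈ L', ∃ i, ∃ y ∈ L i, P.Run (p.eval x.length)
        (Sum.inl P.start, Function.update (fun _ => []) inp x)
        (Sum.inr (some i), Function.update (fun _ => []) out y.reverse)) :
    PolyTimeDecidable L' := by
  classical
  choose χ hχ hM using hL
  let M := fun i => (hM i).some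
  let Q : Polynomial ℕ := ∑ i, (M i).time
  refine ⟨fun x => decide (x ∈ L'), by simp, ⟨{
    tm := machine P inp out (fun i => (M i).tm) (fun i => (M i).inputAlphabet)
      (fun i => (M i).outputAlphabet)
    inputAlphabet := Equiv.refl Bool
    outputAlphabet := Equiv.refl Bool
    time := p + (X + C N * p) + 2 + Q.comp (X + C N * p)
    outputsFun := fun x => Nonempty.some ?_ }⟩⟩
  have hm : ∀ (i : ι) {a b : ℕ}, a ≤ b → (M i).time.eval a ≤ Q.eval b := by
    intro i a b hab
    refine ((M i).time.eval_mono_nat hab).trans ?_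
    simp only [Q, eval_finsetSum]
    exact Finset.single_le_sum (f := fun i => ((M i).time).eval b) (fun _ _ => Nat.zero_le _)
      (Finset.mem_univ i)
  have hrun : ∀ i (y : List Bool), P.Run (p.eval x.length)
        (Sum.inl P.start, Function.update (fun _ => []) inp x)
        (Sum.inr (some i), Function.update (fun _ => []) out y.reverse) →
      Nonempty (EvalsToInTime (TM2.step (machineStmt P inp out (fun i => (M i).tm)
          (fun i => (M i).inputAlphabet) (fun i => (M i).outputAlphabet)))
        (progCfg (inp := inp) i none (Sum.inl P.start, Function.update (fun _ => []) inp x))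
        (some ⟨none, (none, vinit fun i => (M i).tm), joint (fun i => (M i).tm)
          (Function.update (fun _ => []) inp [χ i y]) i fun _ => []⟩)
        ((p + (X + C N * p) + 2 + Q.comp (X + C N * p)).eval x.length)) := by
    intro i y h
    have hlen : y.length ≤ x.length + N * p.eval x.length := by
      have := h.sum_length_le hN
      have aux : ∀ (s : S) (l : List Bool),
          ∑ t, (Function.update (fun _ => []) s l t).length = l.length := by
        intro s l
        rw [Finset.sum_eq_single s (fun t _ ht => by simp [ht]) (by simp)]
        simp
      simpa [aux] using this
    obtain ⟨x', hx'⟩ := evals_prog (inp := inp) (out := out) (M := fun i => (M i).tm)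
      (e := fun i => (M i).inputAlphabet) (o := fun i => (M i).outputAlphabet) i h none
    have h2 := evals_feed (P := P) (inp := inp) (out := out) (M := fun i => (M i).tm)
      (e := fun i => (M i).inputAlphabet) (o := fun i => (M i).outputAlphabet) i x' y.reverse []
    have h3 := evals_sub (P := P) (inp := inp) (out := out) (M := fun i => (M i).tm)
      (e := fun i => (M i).inputAlphabet) (o := fun i => (M i).outputAlphabet) i
      ((M i).outputsFun y)
    have h4 := evals_finish (P := P) (inp := inp) (out := out) (M := fun i => (M i).tm)
      (e := fun i => (M i).inputAlphabet) (o := fun i => (M i).outputAlphabet) i (χ i y)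
    rw [initList_eq] at h3
    have h5 : Function.update (fun _ => []) (M i).tm.k₀ ([] : List ((M i).tm.Γ (M i).tm.k₀)) =
        fun _ => [] := Function.update_eq_self (M i).tm.k₀ _
    rw [h5, List.reverse_reverse, List.append_nil, List.length_reverse] at h2
    have h3' : subCfg (P := P) (S := S) (M := fun i => (M i).tm) i
        ⟨some (M i).tm.main, (M i).tm.initialState, Function.update (fun _ => []) (M i).tm.k₀
          (List.map (M i).inputAlphabet.invFun (id y))⟩ =
        ⟨some (Sum.inr (Sum.inr (Sum.inl ⟨i, (M i).tm.main⟩))), (none, vinit fun i => (M i).tm),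
        joint (fun i => (M i).tm) (fun _ => []) i (Function.update (fun _ => []) (M i).tm.k₀
          (y.map (M i).inputAlphabet.symm))⟩ := by
      simp only [subCfg, Option.elim, id]
      rw [Function.update_eq_self i (vinit fun i => (M i).tm)]
      rfl
    rw [h3'] at h3
    refine evals_mono (evals_trans (evals_trans (evals_trans hx' h2) h3) h4) ?_
    have := hm i (le_refl y.length)
    have := hm i hlen
    simp only [eval_add, eval_X, eval_mul, eval_C, eval_comp, id, eval_ofNat]
    omega
  have hgoal : ∀ b, decide (x ∈ L') = b → (∃ i, Nonempty (EvalsToInTime (TM2.step (machineStmt P inp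
          out (fun i => (M i).tm)
          (fun i => (M i).inputAlphabet) (fun i => (M i).outputAlphabet)))
        (progCfg (inp := inp) i none (Sum.inl P.start, Function.update (fun _ => []) inp x))
        (some ⟨none, (none, vinit fun i => (M i).tm), joint (fun i => (M i).tm)
          (Function.update (fun _ => []) inp [b]) i fun _ => []⟩)
        ((p + (X + C N * p) + 2 + Q.comp (X + C N * p)).eval x.length))) →
      Nonempty (TM2OutputsInTime
        (P.machine inp out (fun i => (M i).tm) (fun i => (M i).inputAlphabet)
          fun i => (M i).outputAlphabet)
        (List.map (Equiv.refl Bool).invFun (id x))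
        (some (List.map (Equiv.refl Bool).invFun (Computability.encodeBool (decide (x ∈ L')))))
        (eval (id x).length (p + (X + C N * p) + 2 + Q.comp (X + C N * p)))) := by
    rintro b hb ⟨i, h⟩
    have hj : ∀ l : List Bool, (Function.update (fun _ => []) (Sum.inl inp) l :
        ∀ k, List (CompositeAlphabet (fun i => (M i).tm) k)) =
        joint (fun i => (M i).tm) (Function.update (fun _ => []) inp l) i fun _ => [] := by
      intro l
      rw [← update_joint_inl]
      congr 1
      funext k
      rcases k with s | ⟨j, k⟩
      · rfl
      · rw [joint_nil _ i j, joint_inr]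
    rw [TM2OutputsInTime, initList_eq, hb]
    simp only [Option.map_some]
    rw [haltList_eq]
    have h1 : List.map (Equiv.refl Bool).invFun (id x) = x := List.map_id _
    simp only [progCfg] at h
    rw [← hj, ← hj] at h
    nth_rewrite 1 [← h1] at h
    exact h
  by_cases hx : x ∈ L'
  · obtain ⟨i, y, hy, h⟩ := hacc x hx
    refine hgoal (χ i y) ?_ ⟨i, hrun i y h⟩
    rw [(hχ i y).2 hy]; simp [hx]
  · rcases hrej x hx with h | ⟨i, y, hy, h⟩
    · obtain ⟨x', hx'⟩ := evals_prog (inp := inp) (out := out) (M := fun i => (M i).tm)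
        (e := fun i => (M i).inputAlphabet) (o := fun i => (M i).outputAlphabet) i₀ h none
      refine hgoal false (by simp [hx]) ⟨i₀, evals_mono hx' ?_⟩
      simp only [eval_add, add_assoc]
      exact Nat.le_add_right _ _
    · refine hgoal (χ i y) ?_ ⟨i, hrun i y h⟩
      rw [← hχ i y] at hy
      simp [hx, hy]

end StackProgram

/-! ### Trees of binary choices -/

/-- A computation which reads bits: it returns a value, fails, or reads a bit and goes on in the
left (bit `0`) or the right (bit `1`) subtree. -/
inductive BitTree (α : Type) : Type
  | leaf (a : α)
  | fail
  | node (f t : BitTree α)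

namespace BitTree

variable {α β : Type}

/-- Reading bits from a word, down to a leaf; the rest of the word is returned as well. -/
def run : BitTree α → List Bool → Option (α × List Bool)
  | leaf a, y => some (a, y)
  | fail, _ => none
  | node _ _, [] => none
  | node f _, false :: y => f.run y
  | node _ t, true :: y => t.run y

/-- Replacing each leaf by a tree. -/
def bind : BitTree α → (α → BitTree β) → BitTree β
  | leaf a, k => k a
  | fail, _ => fail
  | node f t, k => node (f.bind k) (t.bind k)

/-- Applying a function to each leaf. -/
def map (g : α → β) : BitTree α → BitTree β
  | leaf a => leaf (g a)
  | fail => fail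
  | node f t => node (f.map g) (t.map g)

/-- The leaves, from left to right. -/
def leaves : BitTree α → List α
  | leaf a => [a]
  | fail => []
  | node f t => f.leaves ++ t.leaves

/-- The largest number of bits read. -/
def height : BitTree α → ℕ
  | leaf _ => 0
  | fail => 0
  | node f t => max f.height t.height + 1

theorem run_bind (t : BitTree α) (k : α → BitTree β) (y : List Bool) :
    (t.bind k).run y = (t.run y).bind fun r => (k r.1).run r.2 := by
  induction t generalizing y with
  | leaf a => simp [bind, run]
  | fail => simp [bind, run]
  | node f t hf ht => rcases y with _ | ⟨_ | _, y⟩ <;> simp [bind, run, hf, ht]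

theorem run_map (t : BitTree α) (g : α → β) (y : List Bool) :
    (t.map g).run y = (t.run y).map fun r => (g r.1, r.2) := by
  induction t generalizing y with
  | leaf a => simp [map, run]
  | fail => simp [map, run]
  | node f t hf ht => rcases y with _ | ⟨_ | _, y⟩ <;> simp [map, run, hf, ht]

theorem leaves_bind (t : BitTree α) (k : α → BitTree β) :
    (t.bind k).leaves = t.leaves.flatMap fun a => (k a).leaves := by
  induction t with
  | leaf a => simp [bind, leaves]
  | fail => simp [bind, leaves]
  | node f t hf ht => simp [bind, leaves, hf, ht]

theorem leaves_map (t : BitTree α) (g : α → β) : (t.map g).leaves = t.leaves.map g := by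
  induction t with
  | leaf a => simp [map, leaves]
  | fail => simp [map, leaves]
  | node f t hf ht => simp [map, leaves, hf, ht]

theorem height_map (t : BitTree α) (g : α → β) : (t.map g).height = t.height := by
  induction t with
  | leaf a => simp [map, height]
  | fail => simp [map, height]
  | node f t hf ht => simp [map, height, hf, ht]

theorem height_bind_le (t : BitTree α) (k : α → BitTree β) (n : ℕ)
    (h : ∀ a ∈ t.leaves, (k a).height ≤ n) : (t.bind k).height ≤ t.height + n := by
  induction t with
  | leaf a => simpa [bind, height, leaves] using h
  | fail => simp [bind, height]
  | node f t hf ht =>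
    have h1 := hf fun a ha => h a (by simp [leaves, ha])
    have h2 := ht fun a ha => h a (by simp [leaves, ha])
    simp only [bind, height]
    omega

theorem mem_leaves_of_run {t : BitTree α} {y y' : List Bool} {a : α}
    (h : t.run y = some (a, y')) : a ∈ t.leaves := by
  induction t generalizing y with
  | leaf a => simp only [run, Option.some.injEq, Prod.mk.injEq] at h; simp [leaves, h.1]
  | fail => simp [run] at h
  | node f t hf ht =>
    rcases y with _ | ⟨_ | _, y⟩
    · simp [run] at h
    · simp [leaves, hf h]
    · simp [leaves, ht h]

theorem length_le_of_run {t : BitTree α} {y y' : List Bool} {a : α}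
    (h : t.run y = some (a, y')) : y.length ≤ y'.length + t.height ∧ y'.length ≤ y.length := by
  induction t generalizing y with
  | leaf a => simp only [run, Option.some.injEq, Prod.mk.injEq] at h; simp [h.2]
  | fail => simp [run] at h
  | node f t hf ht =>
    rcases y with _ | ⟨_ | _, y⟩
    · simp [run] at h
    · have := hf h; simp [height]; omega
    · have := ht h; simp [height]; omega

/-- The words that lead to a leaf and continue there with a word in a given set are counted by
a sum over the leaves. -/
theorem encard_run (t : BitTree α) (Q : α → Set (List Bool)) :
    {y | ∃ a y', t.run y = some (a, y') ∧ y' ∈ Q a}.encard =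
      (t.leaves.map fun a => (Q a).encard).sum := by
  induction t with
  | leaf a =>
    simp only [leaves, List.map_cons, List.map_nil, List.sum_cons, List.sum_nil, add_zero]
    congr 1
    ext y
    simp only [run, Option.some.injEq, Prod.mk.injEq, Set.mem_ofPred_eq]
    constructor
    · rintro ⟨_, _, ⟨rfl, rfl⟩, h⟩; exact h
    · exact fun h => ⟨_, _, ⟨rfl, rfl⟩, h⟩
  | fail => simp [run, leaves]
  | node f t hf ht =>
    rw [leaves, List.map_append, List.sum_append, ← hf, ← ht]
    have hinj : ∀ b : Bool, Function.Injective (List.cons b) := fun b => List.cons_injective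
    have hun : {y | ∃ a y', (node f t).run y = some (a, y') ∧ y' ∈ Q a} =
        List.cons false '' {y | ∃ a y', f.run y = some (a, y') ∧ y' ∈ Q a} ∪
        List.cons true '' {y | ∃ a y', t.run y = some (a, y') ∧ y' ∈ Q a} := by
      ext y
      rcases y with _ | ⟨_ | _, y⟩ <;> simp [run]
    rw [hun, Set.encard_union_eq, (hinj false).encard_image, (hinj true).encard_image]
    rw [Set.disjoint_left]
    rintro _ ⟨y, -, rfl⟩ ⟨y', -, h⟩
    simp at h

end BitTree

/-! ### Raising operators and merging of parts, as trees of binary choices -/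

/-- For each entry `b` of the list, one reads a bit and, if it is `1`, moves a unit from `b` to `c`
and changes the sign `s`. Entries must not become negative. -/
def raiseTree : List ℕ → ℕ → Bool → BitTree (List ℕ × ℕ × Bool)
  | [], c, s => .leaf ([], c, s)
  | 0 :: B, c, s => .node ((raiseTree B c s).map fun r => (0 :: r.1, r.2)) .fail
  | (b + 1) :: B, c, s => .node ((raiseTree B c s).map fun r => ((b + 1) :: r.1, r.2))
      ((raiseTree B (c + 1) (!s)).map fun r => (b :: r.1, r.2))

/-- For each entry `r` of the first list one moves units to it from the current list, as
in `raiseTree`, and puts it in front of the current list. -/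
def rowsTree : List ℕ → List ℕ → Bool → BitTree (List ℕ × Bool)
  | [], B, s => .leaf (B, s)
  | r :: R, B, s => (raiseTree B r s).bind fun x => rowsTree R (x.2.1 :: x.1) x.2.2

/-- Merging of consecutive entries of the list `p :: l`. If `mg` is `false`, nothing is merged. -/
def mergeTree (mg : Bool) : ℕ → List ℕ → BitTree (List ℕ)
  | p, [] => .leaf [p]
  | p, q :: l =>
    if mg then .node ((mergeTree mg q l).map (p :: ·)) (mergeTree mg (p + q) l)
    else (mergeTree mg q l).map (p :: ·)

/-- Merging of consecutive entries of a list, after its zeros have been removed. -/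
def finTree (mg : Bool) (B : List ℕ) : BitTree (List ℕ) :=
  match B.filter fun a => a ≠ 0 with
  | [] => .leaf []
  | p :: l => mergeTree mg p l

/-- Raising, followed by merging. -/
def coreTree (mg : Bool) (R : List ℕ) : BitTree (List ℕ × Bool) :=
  (rowsTree R [] false).bind fun x => (finTree mg x.1).map fun α => (α, x.2)

@[simp] theorem unaryWord_nil : unaryWord [] = [] := rfl

@[simp] theorem unaryWord_cons (a : ℕ) (l : List ℕ) :
    unaryWord (a :: l) = List.replicate a true ++ false :: unaryWord l := by
  simp [unaryWord]

theorem length_unaryWord_cons (a : ℕ) (l : List ℕ) :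
    (unaryWord (a :: l)).length = (unaryWord l).length + a + 1 := by
  simp; omega

theorem raiseTree_leaves {B : List ℕ} {c : ℕ} {s : Bool} {x} (h : x ∈ (raiseTree B c s).leaves) :
    (unaryWord x.1).length + x.2.1 = (unaryWord B).length + c := by
  induction B generalizing c s x with
  | nil => simp [raiseTree, BitTree.leaves] at h; simp [h]
  | cons b B ih =>
    rcases b with _ | b
    · simp only [raiseTree, BitTree.leaves, BitTree.leaves_map, List.append_nil, List.mem_map] at h
      obtain ⟨x, hx, rfl⟩ := h
      have := ih hx
      simp only [length_unaryWord_cons]; omega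
    · simp only [raiseTree, BitTree.leaves, BitTree.leaves_map, List.mem_append, List.mem_map] at h
      obtain ⟨x, hx, rfl⟩ | ⟨x, hx, rfl⟩ := h
      · have := ih hx
        simp only [length_unaryWord_cons]; omega
      · have := ih hx
        simp only [length_unaryWord_cons]; omega

theorem raiseTree_height (B : List ℕ) (c : ℕ) (s : Bool) :
    (raiseTree B c s).height ≤ (unaryWord B).length := by
  induction B generalizing c s with
  | nil => simp [raiseTree, BitTree.height]
  | cons b B ih =>
    have h1 := ih c s
    have h2 := ih (c + 1) (!s)
    rcases b with _ | b <;> simp only [raiseTree, BitTree.height, BitTree.height_map,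
      length_unaryWord_cons] <;> omega

theorem rowsTree_leaves {R B : List ℕ} {s : Bool} {x} (h : x ∈ (rowsTree R B s).leaves) :
    (unaryWord x.1).length = (unaryWord R).length + (unaryWord B).length := by
  induction R generalizing B s with
  | nil => simp [rowsTree, BitTree.leaves] at h; simp [h]
  | cons r R ih =>
    simp only [rowsTree, BitTree.leaves_bind, List.mem_flatMap] at h
    obtain ⟨z, hz, h⟩ := h
    have := ih h
    have := raiseTree_leaves hz
    simp only [length_unaryWord_cons] at *
    omega

theorem rowsTree_height {R B : List ℕ} {s : Bool} {N : ℕ}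
    (hN : (unaryWord R).length + (unaryWord B).length ≤ N) :
    (rowsTree R B s).height ≤ R.length * N := by
  induction R generalizing B s with
  | nil => simp [rowsTree, BitTree.height]
  | cons r R ih =>
    refine (BitTree.height_bind_le _ _ (R.length * N) fun x hx => ih ?_).trans ?_
    · have := raiseTree_leaves hx
      simp only [length_unaryWord_cons] at *
      omega
    · have := raiseTree_height B r s
      rw [List.length_cons, add_mul]
      omega

theorem mergeTree_leaves {mg : Bool} {p : ℕ} {l : List ℕ} {x} (h : x ∈ (mergeTree mg p l).leaves) :
    (unaryWord x).length ≤ (unaryWord (p :: l)).length := by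
  induction l generalizing p x with
  | nil => simp [mergeTree, BitTree.leaves] at h; simp [h]
  | cons q l ih =>
    have key : x ∈ (BitTree.map (p :: ·) (mergeTree mg q l)).leaves →
        (unaryWord x).length ≤ (unaryWord (p :: q :: l)).length := by
      rw [BitTree.leaves_map, List.mem_map]
      rintro ⟨x, hx, rfl⟩
      have := ih hx
      simp only [length_unaryWord_cons] at *
      omega
    rw [mergeTree] at h
    split_ifs at h
    · simp only [BitTree.leaves, List.mem_append] at h
      obtain h | h := h
      · exact key h
      · have := ih h
        simp only [length_unaryWord_cons] at *
        omega
    · exact key h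

theorem mergeTree_height (mg : Bool) (p : ℕ) (l : List ℕ) :
    (mergeTree mg p l).height ≤ l.length := by
  induction l generalizing p with
  | nil => simp [mergeTree, BitTree.height]
  | cons q l ih =>
    have h1 := ih q
    have h2 := ih (p + q)
    rw [mergeTree]
    split_ifs <;> simp only [BitTree.height, BitTree.height_map, List.length_cons] <;> omega

theorem length_le_unaryWord (l : List ℕ) : l.length ≤ (unaryWord l).length := by
  induction l with
  | nil => simp
  | cons a l ih => rw [length_unaryWord_cons, List.length_cons]; omega

theorem length_unaryWord_filter (l : List ℕ) :
    (unaryWord (l.filter fun a => a ≠ 0)).length ≤ (unaryWord l).length := by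
  induction l with
  | nil => simp
  | cons a l ih =>
    rw [List.filter_cons]
    split_ifs <;> simp only [length_unaryWord_cons] <;> omega

theorem finTree_leaves {mg : Bool} {B : List ℕ} {x} (h : x ∈ (finTree mg B).leaves) :
    (unaryWord x).length ≤ (unaryWord B).length := by
  have := length_unaryWord_filter B
  rw [finTree] at h
  split at h
  · simp [BitTree.leaves] at h
    simp [h]
  · next p l hl => rw [hl] at this; exact (mergeTree_leaves h).trans this

theorem finTree_height (mg : Bool) (B : List ℕ) :
    (finTree mg B).height ≤ (unaryWord B).length := by
  have := length_unaryWord_filter B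
  rw [finTree]
  split
  · simp [BitTree.height]
  · next p l hl =>
    have h2 := mergeTree_height mg p l
    have h3 := length_le_unaryWord l
    rw [hl, length_unaryWord_cons] at this
    omega

theorem coreTree_leaves {mg : Bool} {R : List ℕ} {x} (h : x ∈ (coreTree mg R).leaves) :
    (unaryWord x.1).length ≤ (unaryWord R).length := by
  simp only [coreTree, BitTree.leaves_bind, BitTree.leaves_map, List.mem_flatMap,
    List.mem_map] at h
  obtain ⟨z, hz, α, hα, rfl⟩ := h
  have h1 := rowsTree_leaves hz
  have h2 := finTree_leaves hα
  simp only [unaryWord_nil, List.length_nil] at h1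
  simp only
  omega

theorem coreTree_height (mg : Bool) (R : List ℕ) :
    (coreTree mg R).height ≤ (unaryWord R).length ^ 2 + (unaryWord R).length := by
  refine (BitTree.height_bind_le _ _ (unaryWord R).length fun x hx => ?_).trans ?_
  · have h1 := rowsTree_leaves hx
    have h2 := finTree_height mg x.1
    simp only [unaryWord_nil, List.length_nil] at h1
    rw [BitTree.height_map]
    omega
  · have h1 := rowsTree_height (R := R) (B := []) (s := false) le_rfl
    have h2 := Nat.mul_le_mul_right (unaryWord R).length (length_le_unaryWord R)
    simp only [unaryWord_nil, List.length_nil, add_zero] at h1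
    rw [sq]
    omega

/-! ### The program which raises and merges -/

/-- The stacks: input, output, rows still to be processed, rows already processed, counter of the
current row, and rows passed in the current sweep. -/
inductive Stk
  | inp | out | a | b | c | d
  deriving DecidableEq

instance : Fintype Stk :=
  ⟨{.inp, .out, .a, .b, .c, .d}, fun x => by cases x <;> simp⟩

/-- The contents of the six stacks. -/
def stk (i o a b c d : List Bool) : Stk → List Bool
  | .inp => i | .out => o | .a => a | .b => b | .c => c | .d => d

namespace stk

variable (i o a b c d x : List Bool)

@[simp] theorem inp : stk i o a b c d .inp = i := rfl
@[simp] theorem out : stk i o a b c d .out = o := rfl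
@[simp] theorem a_eq : stk i o a b c d .a = a := rfl
@[simp] theorem b_eq : stk i o a b c d .b = b := rfl
@[simp] theorem c_eq : stk i o a b c d .c = c := rfl
@[simp] theorem d_eq : stk i o a b c d .d = d := rfl

@[simp] theorem update_inp : Function.update (stk i o a b c d) .inp x = stk x o a b c d := by
  funext s; cases s <;> simp
@[simp] theorem update_out : Function.update (stk i o a b c d) .out x = stk i x a b c d := by
  funext s; cases s <;> simp
@[simp] theorem update_a : Function.update (stk i o a b c d) .a x = stk i o x b c d := by
  funext s; cases s <;> simp
@[simp] theorem update_b : Function.update (stk i o a b c d) .b x = stk i o a x c d := by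
  funext s; cases s <;> simp
@[simp] theorem update_c : Function.update (stk i o a b c d) .c x = stk i o a b x d := by
  funext s; cases s <;> simp
@[simp] theorem update_d : Function.update (stk i o a b c d) .d x = stk i o a b c x := by
  funext s; cases s <;> simp

end stk

theorem nil_eq_stk : (fun _ => [] : Stk → List Bool) = stk [] [] [] [] [] [] := by
  funext s; cases s <;> rfl

/-- The labels of the program. From `row` on, a label carries the current sign.

* `pair0`, …, `pair3` copy the part of the input that encodes `w` to `out`, and `read0`, `read1`
  push `l` on `a`; `dropTop` drops the top of `a`.
* `row` moves a number from `a` to the counter `c`. Then `sweep`, `chooseT`, `chooseF` and `move`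
  carry out `raiseTree`, moving the rows from `b` to `d`; `restore` moves them back, and `put` puts
  the counter on top of them.
* `skip`, `part`, `gap` and `merge` carry out `finTree`, and `rest` copies the rest of the input.
* `clean` empties the stacks one after the other, starting with `k`. -/
inductive RaiseLab
  | pair0 | pair1 | pair2 | pair3 | read0 | read1 | dropTop
  | row (s : Bool) | sweep (s : Bool) | chooseT (s : Bool) | chooseF (s : Bool) | move (s : Bool)
  | restore (s : Bool) | put (s : Bool)
  | skip (s : Bool) | part (s : Bool) | gap (s : Bool) | merge (s : Bool) | rest (s : Bool)
  | clean (k : Stk)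
  deriving Fintype

open RaiseLab in
/-- The stack popped by a label. -/
def RaiseLab.scan : RaiseLab → Stk
  | pair0 | pair1 | pair2 | pair3 | read0 | read1 => .inp
  | dropTop => .a
  | row _ => .a
  | sweep _ => .b
  | chooseT _ | chooseF _ => .inp
  | move _ => .b
  | restore _ => .d
  | put _ => .c
  | skip _ | part _ | gap _ => .b
  | merge _ | rest _ => .inp
  | clean k => k

open RaiseLab in
/-- What a label does after popping. -/
def RaiseLab.next (mg : Bool) :
    RaiseLab → Option Bool → List (Stk × Bool) × (RaiseLab ⊕ Option Bool)
  | pair0, some true => ([], .inl pair1)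
  | pair0, _ => ([], .inl (clean .inp))
  | pair1, some true => ([], .inl pair2)
  | pair1, some false => ([(.out, true), (.out, false), (.a, false)], .inl read0)
  | pair1, none => ([], .inl (clean .inp))
  | pair2, some true => ([], .inl pair3)
  | pair2, _ => ([], .inl (clean .inp))
  | pair3, some b => ([(.out, true), (.out, true), (.out, true), (.out, b)], .inl pair0)
  | pair3, none => ([], .inl (clean .inp))
  | read0, some true => ([], .inl read1)
  | read0, some false => ([], .inl dropTop)
  | read0, none => ([], .inl (clean .inp))
  | read1, some b => ([(.a, b)], .inl read0)
  | read1, none => ([], .inl (clean .inp))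
  | dropTop, _ => ([], .inl (row false))
  | row s, some true => ([(.c, true)], .inl (row s))
  | row s, some false => ([], .inl (sweep s))
  | row s, none => ([], .inl (skip s))
  | sweep s, some true => ([], .inl (chooseT s))
  | sweep s, some false => ([], .inl (chooseF s))
  | sweep s, none => ([], .inl (restore s))
  | chooseT s, some true => ([(.c, true)], .inl (move (!s)))
  | chooseT s, some false => ([(.d, true)], .inl (move s))
  | chooseT _, none => ([], .inl (clean .inp))
  | chooseF s, some false => ([(.d, false)], .inl (sweep s))
  | chooseF _, _ => ([], .inl (clean .inp))
  | move s, some true => ([(.d, true)], .inl (move s))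
  | move s, some false => ([(.d, false)], .inl (sweep s))
  | move _, none => ([], .inl (clean .inp))
  | restore s, some b => ([(.b, b)], .inl (restore s))
  | restore s, none => ([(.b, false)], .inl (put s))
  | put s, some _ => ([(.b, true)], .inl (put s))
  | put s, none => ([], .inl (row s))
  | skip s, some true => ([(.out, true), (.out, true)], .inl (part s))
  | skip s, some false => ([], .inl (skip s))
  | skip s, none => ([(.out, false)], .inl (rest s))
  | part s, some true => ([(.out, true), (.out, true)], .inl (part s))
  | part s, some false => ([], .inl (gap s))
  | part _, none => ([], .inl (clean .inp))
  | gap s, some true =>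
    if mg then ([], .inl (merge s))
    else ([(.out, true), (.out, false), (.out, true), (.out, true)], .inl (part s))
  | gap s, some false => ([], .inl (gap s))
  | gap s, none => ([(.out, true), (.out, false), (.out, false)], .inl (rest s))
  | merge s, some true => ([(.out, true), (.out, true)], .inl (part s))
  | merge s, some false =>
    ([(.out, true), (.out, false), (.out, true), (.out, true)], .inl (part s))
  | merge _, none => ([], .inl (clean .inp))
  | rest s, some b => ([(.out, b)], .inl (rest s))
  | rest s, none => ([], .inr (some s))
  | clean k, some _ => ([], .inl (clean k))
  | clean .inp, none => ([], .inl (clean .out))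
  | clean .out, none => ([], .inl (clean .a))
  | clean .a, none => ([], .inl (clean .b))
  | clean .b, none => ([], .inl (clean .c))
  | clean .c, none => ([], .inl (clean .d))
  | clean .d, none => ([], .inr none)

/-- The program. It reads a word `pairWord (pairWord w l) y`, copies the beginning which
encodes `w` to `out`, pushes `l` on `a`, and builds up on `b` the rows made by `rowsTree`, with
bits taken from `y`. Then it writes the result of `finTree` and the rest of `y` on `out`. It exits
with the sign. On failure it clears all stacks and rejects. -/
abbrev raiseProgram (mg : Bool) : StackProgram Stk Bool where
  Lab := RaiseLab
  start := .pair0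
  scan := RaiseLab.scan
  next := RaiseLab.next mg

instance (mg : Bool) : Fintype (raiseProgram mg).Lab := inferInstanceAs (Fintype RaiseLab)

theorem raiseProgram_next_length (mg : Bool) (q : (raiseProgram mg).Lab) (x : Option Bool) :
    ((raiseProgram mg).next q x).1.length ≤ 4 := by
  change (RaiseLab.next mg q x).1.length ≤ 4
  change RaiseLab at q
  cases mg <;> rcases x with _ | _ | _ <;> rcases q with _ | _ | _ | _ | _ | _ | _ | _ | _ | _ | _
    | _ | _ | _ | _ | _ | _ | _ | _ | (_ | _ | _ | _ | _ | _) <;> simp [RaiseLab.next]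

namespace RaiseLab

variable {mg : Bool}

/-- `Gets mg n q T r`: from the label `q` and the stacks `T` the program gets to `r` in at most `n`
steps. The value `none` of `r` stands for a failure, where the program starts clearing the
stacks. -/
def Gets (mg : Bool) (n : ℕ) (q : RaiseLab) (T : Stk → List Bool) :
    Option (RaiseLab × (Stk → List Bool)) → Prop
  | none => ∃ T', (raiseProgram mg).Run n (.inl q, T) (.inl (clean .inp), T')
  | some (q', T') => (raiseProgram mg).Run n (.inl q, T) (.inl q', T')

theorem Gets.refl (n : ℕ) (q : RaiseLab) (T : Stk → List Bool) : Gets mg n q T (some (q, T)) :=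
  StackProgram.Run.refl _ _

theorem Gets.mono {n m q T r} (h : Gets mg n q T r) (hm : n ≤ m) : Gets mg m q T r := by
  rcases r with _ | ⟨q', T'⟩
  · obtain ⟨T', h⟩ := h
    exact ⟨T', h.mono hm⟩
  · exact StackProgram.Run.mono h hm

theorem Gets.trans {n m q T q' T' r} (h : Gets mg n q T (some (q', T')))
    (h' : Gets mg m q' T' r) : Gets mg (n + m) q T r := by
  rcases r with _ | ⟨q'', T''⟩
  · obtain ⟨T'', h'⟩ := h'
    exact ⟨T'', StackProgram.Run.trans h h'⟩
  · exact StackProgram.Run.trans h h'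

theorem Gets.bind {α : Type} {n m q T} {x : Option α} {f : α → RaiseLab × (Stk → List Bool)}
    {g : α → Option (RaiseLab × (Stk → List Bool))} (h : Gets mg n q T (x.map f))
    (h' : ∀ y, x = some y → Gets mg m (f y).1 (f y).2 (g y)) :
    Gets mg (n + m) q T (x.bind g) := by
  rcases x with _ | y
  · exact h.mono (Nat.le_add_right _ _)
  · exact Gets.trans h (h' y rfl)

theorem Gets.step {n q q' T r} (T' : Stk → List Bool)
    (hq : (raiseProgram mg).next' q T = (.inl q', T')) (h : Gets mg n q' T' r) :
    Gets mg (n + 1) q T r := by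
  rcases r with _ | ⟨q'', T''⟩
  · obtain ⟨T'', h⟩ := h
    exact ⟨T'', .step (by rw [hq]; exact h)⟩
  · exact StackProgram.Run.step (by rw [hq]; exact h)

theorem Gets.fail {n q T} (hq : ((raiseProgram mg).next' q T).1 = .inl (clean .inp)) :
    Gets mg (n + 1) q T none :=
  ⟨((raiseProgram mg).next' q T).2, .step (by rw [← hq]; exact .refl _ _)⟩

theorem next'_eq (q : RaiseLab) (T : Stk → List Bool) :
    (raiseProgram mg).next' q T = ((RaiseLab.next mg q (T q.scan).head?).2,
    StackProgram.pushAll (RaiseLab.next mg q (T q.scan).head?).1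
      (Function.update T q.scan (T q.scan).tail)) := rfl

theorem cons_replicate_append {α : Type} (x : α) (n : ℕ) (d : List α) :
    x :: (List.replicate n x ++ d) = List.replicate n x ++ x :: d := by
  rw [← List.cons_append, ← List.replicate_succ, List.replicate_succ', List.append_assoc]
  rfl

theorem gets_move (s : Bool) (n : ℕ) (i o a b c d : List Bool) :
    Gets mg (n + 1) (move s) (stk i o a (List.replicate n true ++ false :: b) c d)
      (some (sweep s, stk i o a b c (false :: List.replicate n true ++ d))) := by
  induction n generalizing d with
  | zero =>
    refine .step (stk i o a b c (false :: d)) ?_ (.refl _ _ _)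
    simp [next'_eq, next, scan, StackProgram.pushAll]
  | succ n ih =>
    refine .step (q' := move s)
      (stk i o a (List.replicate n true ++ false :: b) c (true :: d)) ?_ ?_
    · simp [next'_eq, next, scan, StackProgram.pushAll, List.replicate_succ]
    · convert ih (true :: d) using 4
      rw [List.replicate_succ, List.cons_append, List.cons_append, List.cons_append,
        cons_replicate_append]

/-- A sweep over the rows carries out `raiseTree`. -/
theorem gets_sweep (B : List ℕ) (k : ℕ) (s : Bool) (i o a d : List Bool) :
    Gets mg (2 * (unaryWord B).length + 1) (sweep s)
      (stk i o a (unaryWord B) (List.replicate k true) d)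
      (((raiseTree B k s).run i).map fun r => (restore r.1.2.2,
        stk r.2 o a [] (List.replicate r.1.2.1 true) ((unaryWord r.1.1).reverse ++ d))) := by
  induction B generalizing k s i d with
  | nil =>
    refine .step _ ?_ (.refl _ _ _)
    simp [next'_eq, next, scan, StackProgram.pushAll]
  | cons b B ih =>
    rcases b with _ | b
    · refine Gets.mono (n := 2 * (unaryWord B).length + 1 + 1 + 1) ?_
        (by rw [length_unaryWord_cons]; omega)
      refine .step (q' := chooseF s) (stk i o a (unaryWord B) (List.replicate k true) d) ?_ ?_
      · simp [next'_eq, next, scan, StackProgram.pushAll]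
      rcases i with _ | ⟨_ | _, i⟩
      · exact .fail rfl
      · refine .step (q' := sweep s)
          (stk i o a (unaryWord B) (List.replicate k true) (false :: d)) ?_ ?_
        · simp [next'_eq, next, scan, StackProgram.pushAll]
        · convert ih k s i (false :: d) using 1
          simp only [raiseTree, BitTree.run, BitTree.run_map, Option.map_map]
          congr 1
          funext r
          simp
      · exact .fail rfl
    · refine Gets.mono (n := b + 1 + (2 * (unaryWord B).length + 1) + 1 + 1) ?_
        (by rw [length_unaryWord_cons]; omega)
      refine .step (q' := chooseT s) (stk i o a (List.replicate b true ++ false :: unaryWord B)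
        (List.replicate k true) d) ?_ ?_
      · simp [next'_eq, next, scan, StackProgram.pushAll, List.replicate_succ]
      rcases i with _ | ⟨_ | _, i⟩
      · exact .fail rfl
      · refine .step (q' := move s) (stk i o a (List.replicate b true ++ false :: unaryWord B)
          (List.replicate k true) (true :: d)) ?_ (.trans (gets_move _ _ _ _ _ _ _ _) ?_)
        · simp [next'_eq, next, scan, StackProgram.pushAll]
        · convert ih k s i _ using 1
          simp only [raiseTree, BitTree.run, BitTree.run_map, Option.map_map]
          congr 1
          funext r
          simp [List.replicate_succ, cons_replicate_append]
      · refine .step (q' := move !s) (stk i o a (List.replicate b true ++ false :: unaryWord B)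
          (List.replicate (k + 1) true) d) ?_ (.trans (gets_move _ _ _ _ _ _ _ _) ?_)
        · simp [next'_eq, next, scan, StackProgram.pushAll, List.replicate_succ]
        · convert ih (k + 1) (!s) i _ using 1
          simp only [raiseTree, BitTree.run, BitTree.run_map, Option.map_map]
          congr 1
          funext r
          simp

theorem gets_row (s : Bool) (r k : ℕ) (i o a b : List Bool) :
    Gets mg (r + 1) (row s)
      (stk i o (List.replicate r true ++ false :: a) b (List.replicate k true) [])
      (some (sweep s, stk i o a b (List.replicate (k + r) true) [])) := by
  induction r generalizing k with
  | zero =>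
    refine .step _ ?_ (.refl _ _ _)
    simp [next'_eq, next, scan, StackProgram.pushAll]
  | succ r ih =>
    refine .step (q' := row s)
      (stk i o (List.replicate r true ++ false :: a) b (List.replicate (k + 1) true) []) ?_ ?_
    · simp [next'_eq, next, scan, StackProgram.pushAll, List.replicate_succ]
    · convert ih (k + 1) using 5
      omega

theorem gets_put (s : Bool) (k : ℕ) (i o a b : List Bool) :
    Gets mg (k + 1) (put s) (stk i o a b (List.replicate k true) [])
      (some (row s, stk i o a (List.replicate k true ++ b) [] [])) := by
  induction k generalizing b with
  | zero =>
    refine .step _ ?_ (.refl _ _ _)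
    simp [next'_eq, next, scan, StackProgram.pushAll]
  | succ k ih =>
    refine .step (q' := put s) (stk i o a (true :: b) (List.replicate k true) []) ?_ ?_
    · simp [next'_eq, next, scan, StackProgram.pushAll, List.replicate_succ]
    · convert ih (true :: b) using 4
      rw [List.replicate_succ', List.append_assoc]
      rfl

theorem gets_restore (s : Bool) (i o a b c d : List Bool) :
    Gets mg (d.length + 1) (restore s) (stk i o a b c d)
      (some (put s, stk i o a (false :: (d.reverse ++ b)) c [])) := by
  induction d generalizing b with
  | nil =>
    refine .step _ ?_ (.refl _ _ _)
    simp [next'_eq, next, scan, StackProgram.pushAll]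
  | cons x d ih =>
    refine .step (q' := restore s) (stk i o a (x :: b) c d) ?_ ?_
    · simp [next'_eq, next, scan, StackProgram.pushAll]
    · convert ih (x :: b) using 4 <;> simp

/-- The passage through all rows carries out `rowsTree`. Each row costs one sweep over at most `N`
bits. -/
theorem gets_rows (N : ℕ) (R B : List ℕ) (s : Bool) (i o : List Bool)
    (hN : (unaryWord R).length + (unaryWord B).length ≤ N) :
    Gets mg (R.length * (6 * N + 6) + 1) (row s) (stk i o (unaryWord R) (unaryWord B) [] [])
      (((rowsTree R B s).run i).map fun r => (skip r.1.2,
        stk r.2 o [] (unaryWord r.1.1) [] [])) := by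
  induction R generalizing B s i with
  | nil =>
    refine .mono (.step (n := 0) _ ?_ (.refl _ _ _)) (by simp)
    simp [next'_eq, next, scan, StackProgram.pushAll]
  | cons r R ih =>
    have hmap : ((rowsTree (r :: R) B s).run i).map (fun r => (skip r.1.2,
        stk r.2 o [] (unaryWord r.1.1) [] [])) = ((raiseTree B r s).run i).bind fun x =>
        ((rowsTree R (x.1.2.1 :: x.1.1) x.1.2.2).run x.2).map fun r => (skip r.1.2,
        stk r.2 o [] (unaryWord r.1.1) [] []) := by
      rw [rowsTree, BitTree.run_bind, Option.map_bind]
      rfl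
    rw [hmap]
    rw [length_unaryWord_cons] at hN
    have h1 := gets_row (mg := mg) s r 0 i o (unaryWord R) (unaryWord B)
    rw [zero_add] at h1
    refine .mono (n := (r + 1) + ((2 * (unaryWord B).length + 1) +
      (2 * N + 2 + (R.length * (6 * N + 6) + 1)))) ?_ (by
        rw [List.length_cons, add_mul]; omega)
    rw [unaryWord_cons]
    refine .trans h1 (.bind (gets_sweep _ _ _ _ _ _ _) fun x hx => ?_)
    have hlen := raiseTree_leaves (BitTree.mem_leaves_of_run hx)
    have h2 := gets_restore (mg := mg) x.1.2.2 x.2 o (unaryWord R) []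
      (List.replicate x.1.2.1 true) ((unaryWord x.1.1).reverse)
    have h3 := gets_put (mg := mg) x.1.2.2 x.1.2.1 x.2 o (unaryWord R)
      (false :: unaryWord x.1.1)
    have h4 := ih (x.1.2.1 :: x.1.1) x.1.2.2 x.2 (by rw [length_unaryWord_cons]; omega)
    rw [List.reverse_reverse, List.append_nil, List.length_reverse] at h2
    rw [unaryWord_cons] at h4
    have h5 := (h2.trans h3).mono (m := 2 * N + 2) (by omega)
    simp only [List.append_nil]
    exact h5.trans h4

/-- Every bit is preceded by a `1`. -/
def dbl (l : List Bool) : List Bool := l.flatMap fun b => [true, b]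

@[simp] theorem dbl_nil : dbl [] = [] := rfl

@[simp] theorem dbl_cons (b : Bool) (l : List Bool) : dbl (b :: l) = true :: b :: dbl l := rfl

@[simp] theorem dbl_append (l l' : List Bool) : dbl (l ++ l') = dbl l ++ dbl l' := by
  simp [dbl]

theorem gets_part (s : Bool) (m : ℕ) (i o b : List Bool) :
    Gets mg (m + 1) (part s) (stk i o [] (List.replicate m true ++ false :: b) [] [])
      (some (gap s, stk i ((dbl (List.replicate m true)).reverse ++ o) [] b [] [])) := by
  induction m generalizing o with
  | zero =>
    refine .step _ ?_ (.refl _ _ _)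
    simp [next'_eq, next, scan, StackProgram.pushAll]
  | succ m ih =>
    refine .step (q' := part s)
      (stk i (true :: true :: o) [] (List.replicate m true ++ false :: b) [] []) ?_ ?_
    · simp [next'_eq, next, scan, StackProgram.pushAll, List.replicate_succ]
    · convert ih (true :: true :: o) using 4
      simp [List.replicate_succ]

/-- From the label `gap`, where `p` units of the current part have been written, the program
carries out `mergeTree`. -/
theorem gets_gap (s : Bool) (B : List ℕ) (p : ℕ) (i o : List Bool) :
    Gets mg (2 * (unaryWord B).length + 1) (gap s)
      (stk i ((dbl (List.replicate p true)).reverse ++ o) [] (unaryWord B) [] [])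
      (((mergeTree mg p (B.filter fun a => a ≠ 0)).run i).map fun r => (rest s,
        stk r.2 (false :: ((dbl (unaryWord r.1)).reverse ++ o)) [] [] [] [])) := by
  induction B generalizing p i o with
  | nil =>
    refine .step _ ?_ (.refl _ _ _)
    simp [next'_eq, next, scan, StackProgram.pushAll]
  | cons q B ih =>
    rcases q with _ | q
    · rw [length_unaryWord_cons]
      refine .mono (.step (q' := gap s) _ ?_ (ih p i o)) (by omega)
      simp [next'_eq, next, scan, StackProgram.pushAll]
    · rw [List.filter_cons_of_pos (by simp), length_unaryWord_cons]
      have h0 : ∀ i, Gets mg ((q + 1) + (2 * (unaryWord B).length + 1)) (part s)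
          (stk i (true :: true :: false :: true :: ((dbl (List.replicate p true)).reverse ++ o)) []
            (List.replicate q true ++ false :: unaryWord B) [] [])
          ((((mergeTree mg (q + 1) (B.filter fun a => a ≠ 0)).map (p :: ·)).run i).map fun r =>
            (rest s, stk r.2 (false :: ((dbl (unaryWord r.1)).reverse ++ o)) [] [] [] [])) := by
        refine fun i => .trans (gets_part _ _ _ _ _) ?_
        convert ih (q + 1) i (false :: true :: ((dbl (List.replicate p true)).reverse ++ o)) using 1
        · simp [List.replicate_succ]
        · rw [BitTree.run_map, Option.map_map]
          congr 1
          funext r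
          simp
      have h1 : ∀ i, Gets mg ((q + 1) + (2 * (unaryWord B).length + 1)) (part s)
          (stk i (true :: true :: ((dbl (List.replicate p true)).reverse ++ o)) []
            (List.replicate q true ++ false :: unaryWord B) [] [])
          (((mergeTree mg (p + (q + 1)) (B.filter fun a => a ≠ 0)).run i).map fun r =>
            (rest s, stk r.2 (false :: ((dbl (unaryWord r.1)).reverse ++ o)) [] [] [] [])) := by
        refine fun i => .trans (gets_part _ _ _ _ _) ?_
        convert ih (p + (q + 1)) i o using 1
        rw [List.replicate_add, List.replicate_succ]
        simp
      rcases mg with _ | _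
      · refine .mono (n := (q + 1) + (2 * (unaryWord B).length + 1) + 1)
          (.step (q' := part s) _ ?_ (h0 i)) (by omega)
        simp [next'_eq, next, scan, StackProgram.pushAll, List.replicate_succ]
      · refine .mono (n := (q + 1) + (2 * (unaryWord B).length + 1) + 1 + 1)
          (.step (q' := merge s) (stk i ((dbl (List.replicate p true)).reverse ++ o) []
            (List.replicate q true ++ false :: unaryWord B) [] []) ?_ ?_) (by omega)
        · simp [next'_eq, next, scan, StackProgram.pushAll, List.replicate_succ]
        · rcases i with _ | ⟨_ | _, i⟩
          · exact .fail rfl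
          · refine .step (q' := part s) _ ?_ (h0 i)
            simp [next'_eq, next, scan, StackProgram.pushAll]
          · refine .step (q' := part s) _ ?_ (h1 i)
            simp [next'_eq, next, scan, StackProgram.pushAll]

/-- From the label `skip`, the program carries out `finTree`. -/
theorem gets_skip (s : Bool) (B : List ℕ) (i o : List Bool) :
    Gets mg (2 * (unaryWord B).length + 1) (skip s) (stk i o [] (unaryWord B) [] [])
      (((finTree mg B).run i).map fun r => (rest s,
        stk r.2 (false :: ((dbl (unaryWord r.1)).reverse ++ o)) [] [] [] [])) := by
  induction B with
  | nil =>
    refine .step _ ?_ (.refl _ _ _)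
    simp [next'_eq, next, scan, StackProgram.pushAll]
  | cons q B ih =>
    rcases q with _ | q
    · rw [length_unaryWord_cons]
      refine .mono (.step (q' := skip s) _ ?_ ih) (by omega)
      simp [next'_eq, next, scan, StackProgram.pushAll]
    · rw [length_unaryWord_cons, finTree, List.filter_cons_of_pos (by simp)]
      refine .mono (n := (q + 1) + (2 * (unaryWord B).length + 1) + 1)
        (.step (q' := part s) (stk i (true :: true :: o) []
          (List.replicate q true ++ false :: unaryWord B) [] []) ?_
          (.trans (gets_part _ _ _ _ _) ?_)) (by omega)
      · simp [next'_eq, next, scan, StackProgram.pushAll, List.replicate_succ]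
      · convert gets_gap s B (q + 1) i o using 1
        simp [List.replicate_succ]

/-- The rest of the input is copied, and the program exits with the sign. -/
theorem run_rest (s : Bool) (i o : List Bool) :
    (raiseProgram mg).Run (i.length + 1) (.inl (rest s), stk i o [] [] [] [])
      (.inr (some s), stk [] (i.reverse ++ o) [] [] [] []) := by
  induction i generalizing o with
  | nil =>
    refine .step ?_
    rw [next'_eq]
    simpa [next, scan, StackProgram.pushAll] using .refl _ _
  | cons b i ih =>
    refine .step ?_
    rw [next'_eq]
    simpa [next, scan, StackProgram.pushAll] using ih (b :: o)

/-- After a failure all stacks are cleared and the program rejects. -/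
theorem run_clean (T : Stk → List Bool) :
    (raiseProgram mg).Run (∑ s, (T s).length + 6) (.inl (clean .inp), T)
      (.inr none, fun _ => []) := by
  obtain ⟨i, o, a, b, c, d, rfl⟩ : ∃ i o a b c d, T = stk i o a b c d :=
    ⟨T .inp, T .out, T .a, T .b, T .c, T .d, by funext s; cases s <;> rfl⟩
  rw [nil_eq_stk]
  have hi : ∀ i, (raiseProgram mg).Run (i.length + 1) (.inl (clean .inp), stk i o a b c d)
      (.inl (clean .out), stk [] o a b c d) := by
    intro i
    induction i with
    | nil => exact .step (by simpa [next'_eq, next, scan, StackProgram.pushAll] using .refl _ _)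
    | cons x i ih => exact .step (by simpa [next'_eq, next, scan, StackProgram.pushAll] using ih)
  have ho : ∀ o, (raiseProgram mg).Run (o.length + 1) (.inl (clean .out), stk [] o a b c d)
      (.inl (clean .a), stk [] [] a b c d) := by
    intro o
    induction o with
    | nil => exact .step (by simpa [next'_eq, next, scan, StackProgram.pushAll] using .refl _ _)
    | cons x i ih => exact .step (by simpa [next'_eq, next, scan, StackProgram.pushAll] using ih)
  have ha : ∀ a, (raiseProgram mg).Run (a.length + 1) (.inl (clean .a), stk [] [] a b c d)
      (.inl (clean .b), stk [] [] [] b c d) := by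
    intro a
    induction a with
    | nil => exact .step (by simpa [next'_eq, next, scan, StackProgram.pushAll] using .refl _ _)
    | cons x i ih => exact .step (by simpa [next'_eq, next, scan, StackProgram.pushAll] using ih)
  have hb : ∀ b, (raiseProgram mg).Run (b.length + 1) (.inl (clean .b), stk [] [] [] b c d)
      (.inl (clean .c), stk [] [] [] [] c d) := by
    intro b
    induction b with
    | nil => exact .step (by simpa [next'_eq, next, scan, StackProgram.pushAll] using .refl _ _)
    | cons x i ih => exact .step (by simpa [next'_eq, next, scan, StackProgram.pushAll] using ih)
  have hc : ∀ c, (raiseProgram mg).Run (c.length + 1) (.inl (clean .c), stk [] [] [] [] c d)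
      (.inl (clean .d), stk [] [] [] [] [] d) := by
    intro c
    induction c with
    | nil => exact .step (by simpa [next'_eq, next, scan, StackProgram.pushAll] using .refl _ _)
    | cons x i ih => exact .step (by simpa [next'_eq, next, scan, StackProgram.pushAll] using ih)
  have hd : ∀ d, (raiseProgram mg).Run (d.length + 1) (.inl (clean .d), stk [] [] [] [] [] d)
      (.inr none, stk [] [] [] [] [] []) := by
    intro d
    induction d with
    | nil => exact .step (by simpa [next'_eq, next, scan, StackProgram.pushAll] using .refl _ _)
    | cons x i ih => exact .step (by simpa [next'_eq, next, scan, StackProgram.pushAll] using ih)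
  refine ((hi i).trans ((ho o).trans ((ha a).trans ((hb b).trans ((hc c).trans (hd d)))))).mono ?_
  have : ∑ s, (stk i o a b c d s).length =
      i.length + (o.length + (a.length + (b.length + (c.length + d.length)))) := by
    change ∑ s ∈ ({.inp, .out, .a, .b, .c, .d} : Finset Stk), _ = _
    simp
  omega

/-- Reading the inner word of the pair: either the input encodes a pair, or the program fails. -/
theorem gets_read (z o a : List Bool) :
    (∃ l y, z = pairWord l y ∧ Gets mg (z.length + 1) read0 (stk z o a [] [] [])
      (some (dropTop, stk y o (l.reverse ++ a) [] [] []))) ∨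
    ((∀ l y, z ≠ pairWord l y) ∧ Gets mg (z.length + 1) read0 (stk z o a [] [] []) none) := by
  match z with
  | [] => exact .inr ⟨fun l y h => by simp [pairWord] at h, .fail rfl⟩
  | false :: y =>
    refine .inl ⟨[], y, rfl, .step _ ?_ (.refl _ _ _)⟩
    simp [next'_eq, next, scan, StackProgram.pushAll]
  | [true] =>
    refine .inr ⟨fun l y h => ?_, .step (q' := read1) _ rfl (.fail rfl)⟩
    rcases l with _ | ⟨b, l⟩ <;> simp [pairWord] at h
  | true :: b :: z =>
    have hstep : ∀ r, Gets mg (z.length + 1) read0 (stk z o (b :: a) [] [] []) r →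
        Gets mg ((true :: b :: z).length + 1) read0 (stk (true :: b :: z) o a [] [] []) r := by
      intro r h
      refine .step (q' := read1) (stk (b :: z) o a [] [] []) ?_ (.step (q' := read0) _ ?_ h)
      · simp [next'_eq, next, scan, StackProgram.pushAll]
      · simp [next'_eq, next, scan, StackProgram.pushAll]
    rcases gets_read z o (b :: a) with ⟨l, y, rfl, h⟩ | ⟨hz, h⟩
    · refine .inl ⟨b :: l, y, rfl, hstep _ ?_⟩
      simpa using h
    · refine .inr ⟨fun l y h => ?_, hstep _ h⟩
      rcases l with _ | ⟨b', l⟩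
      · simp [pairWord] at h
      · simp only [pairWord, List.flatMap_cons, List.cons_append, List.cons.injEq,
          List.nil_append, true_and] at h
        exact hz l y h.2

theorem pairWord_cons (b : Bool) (l y : List Bool) :
    pairWord (b :: l) y = true :: b :: pairWord l y := rfl

theorem pairWord_pairWord_cons (b : Bool) (w l y : List Bool) :
    pairWord (pairWord (b :: w) l) y = true :: true :: true :: b :: pairWord (pairWord w l) y := rfl

theorem pairWord_pairWord_nil (l y : List Bool) :
    pairWord (pairWord [] l) y = true :: false :: pairWord l y := rfl

/-- The part of `pairWord (pairWord w l) y` which encodes `w`. -/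
def pairHead (w : List Bool) : List Bool := dbl (dbl w) ++ [true, false]

theorem pairWord_pairWord (w l y : List Bool) :
    pairWord (pairWord w l) y = pairHead w ++ dbl l ++ false :: y := by
  simp [pairWord, pairHead, dbl]

/-- Reading the input: either it encodes `(w, l)` and `y`, or the program fails. The bit `0` below
`l` on the stack `a` marks the bottom; together with the dropping of the top bit it turns the
reversed word into the encoding of the reversed sequence. -/
theorem gets_pair (z o : List Bool) :
    (∃ w l y, z = pairWord (pairWord w l) y ∧ Gets mg (z.length + 1) pair0 (stk z o [] [] [] [])
      (some (dropTop, stk y ((pairHead w).reverse ++ o) (l.reverse ++ [false]) [] [] []))) ∨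
    ((∀ w l y, z ≠ pairWord (pairWord w l) y) ∧
      Gets mg (z.length + 1) pair0 (stk z o [] [] [] []) none) := by
  match z with
  | [] => exact .inr ⟨fun w l y h => by simp [pairWord] at h, .fail rfl⟩
  | false :: z =>
    refine .inr ⟨fun w l y h => ?_, .fail rfl⟩
    rcases w with _ | ⟨b, w⟩
    · simp [pairWord_pairWord_nil] at h
    · simp [pairWord_pairWord_cons] at h
  | [true] =>
    refine .inr ⟨fun w l y h => ?_, .step (q' := pair1) _ rfl (.fail rfl)⟩
    rcases w with _ | ⟨b, w⟩
    · simp [pairWord_pairWord_nil] at h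
    · simp [pairWord_pairWord_cons] at h
  | true :: false :: z =>
    have hstep : ∀ r, Gets mg (z.length + 1) read0 (stk z (false :: true :: o) [false] [] [] []) r →
        Gets mg ((true :: false :: z).length + 1) pair0 (stk (true :: false :: z) o [] [] [] [])
          r := by
      intro r h
      refine .step (q' := pair1) (stk (false :: z) o [] [] [] []) ?_ (.step (q' := read0) _ ?_ h)
      · simp [next'_eq, next, scan, StackProgram.pushAll]
      · simp [next'_eq, next, scan, StackProgram.pushAll]
    rcases gets_read z (false :: true :: o) [false] with ⟨l, y, rfl, h⟩ | ⟨hz, h⟩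
    · exact .inl ⟨[], l, y, rfl, hstep _ (by simpa [pairHead] using h)⟩
    · refine .inr ⟨fun w l y h => ?_, hstep _ h⟩
      rcases w with _ | ⟨b, w⟩
      · rw [pairWord_pairWord_nil] at h
        simp only [List.cons.injEq, true_and] at h
        exact hz l y h
      · simp [pairWord_pairWord_cons] at h
  | [true, true] =>
    refine .inr ⟨fun w l y h => ?_, .step (q' := pair1) _ rfl (.step (q' := pair2) _ rfl
      (.fail rfl))⟩
    rcases w with _ | ⟨b, w⟩
    · simp [pairWord_pairWord_nil] at h
    · simp [pairWord_pairWord_cons] at h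
  | true :: true :: false :: z =>
    refine .inr ⟨fun w l y h => ?_, .step (q' := pair1) _ rfl (.step (q' := pair2) _ rfl
      (.fail rfl))⟩
    rcases w with _ | ⟨b, w⟩
    · simp [pairWord_pairWord_nil] at h
    · simp [pairWord_pairWord_cons] at h
  | [true, true, true] =>
    refine .inr ⟨fun w l y h => ?_, .step (q' := pair1) _ rfl (.step (q' := pair2) _ rfl
      (.step (q' := pair3) _ rfl (.fail rfl)))⟩
    rcases w with _ | ⟨b, w⟩
    · simp [pairWord_pairWord_nil] at h
    · simp [pairWord_pairWord_cons] at h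
  | true :: true :: true :: b :: z =>
    have hstep : ∀ r, Gets mg (z.length + 1) pair0
        (stk z (b :: true :: true :: true :: o) [] [] [] []) r →
        Gets mg ((true :: true :: true :: b :: z).length + 1) pair0
          (stk (true :: true :: true :: b :: z) o [] [] [] []) r := by
      intro r h
      refine .step (q' := pair1) (stk (true :: true :: b :: z) o [] [] [] []) ?_
        (.step (q' := pair2) (stk (true :: b :: z) o [] [] [] []) ?_
        (.step (q' := pair3) (stk (b :: z) o [] [] [] []) ?_ (.step (q' := pair0) _ ?_ h)))
      all_goals simp [next'_eq, next, scan, StackProgram.pushAll]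
    rcases gets_pair z (b :: true :: true :: true :: o) with ⟨w, l, y, rfl, h⟩ | ⟨hz, h⟩
    · exact .inl ⟨b :: w, l, y, rfl, hstep _ (by simpa [pairHead] using h)⟩
    · refine .inr ⟨fun w l y h => ?_, hstep _ h⟩
      rcases w with _ | ⟨b', w⟩
      · simp [pairWord_pairWord_nil] at h
      · rw [pairWord_pairWord_cons] at h
        simp only [List.cons.injEq, true_and] at h
        exact hz w l y h.2

end RaiseLab

theorem unaryWord_injective : Function.Injective unaryWord := by
  intro l
  induction l with
  | nil => intro l' h; rcases l' with _ | ⟨a, l'⟩ <;> simp at h ⊢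
  | cons a l ih =>
    intro l' h
    rcases l' with _ | ⟨b, l'⟩
    · simp at h
    · simp only [unaryWord_cons] at h
      have hab : ∀ (a b : ℕ) (u v : List Bool), List.replicate a true ++ false :: u =
          List.replicate b true ++ false :: v → a = b ∧ u = v := by
        intro a
        induction a with
        | zero => intro b u v h; rcases b with _ | b <;> simp [List.replicate_succ] at h ⊢; exact h
        | succ a ih =>
          intro b u v h
          rcases b with _ | b
          · simp [List.replicate_succ] at h
          · simp only [List.replicate_succ, List.cons_append, List.cons.injEq, true_and] at h
            simpa using ih b u v h
      obtain ⟨rfl, h'⟩ := hab a b _ _ h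
      rw [ih h']

theorem pairWord_injective {u v u' v' : List Bool} (h : pairWord u v = pairWord u' v') :
    u = u' ∧ v = v' := by
  induction u generalizing u' with
  | nil => rcases u' with _ | ⟨b, u'⟩ <;> simp [pairWord] at h ⊢; exact h
  | cons a u ih =>
    rcases u' with _ | ⟨b, u'⟩
    · simp [pairWord] at h
    · rw [RaiseLab.pairWord_cons, RaiseLab.pairWord_cons] at h
      simp only [List.cons.injEq, true_and] at h
      simpa [h.1] using ih h.2

/-- Any word `l`, reversed, ended by `0` and without its first letter, encodes a sequence, so the
program need not test whether `l` is an encoding. -/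
theorem exists_unaryWord_eq_tail (l : List Bool) :
    ∃ R, unaryWord R = (l.reverse ++ [false]).tail := by
  have key : ∀ m : List Bool, ∃ R, unaryWord R = m ++ [false] := by
    intro m
    induction m with
    | nil => exact ⟨[0], rfl⟩
    | cons b m ih =>
      obtain ⟨R, hR⟩ := ih
      rcases b with _ | _
      · exact ⟨0 :: R, by simp [hR]⟩
      · rcases R with _ | ⟨r, R⟩
        · simp at hR
        · exact ⟨(r + 1) :: R, by simpa [List.replicate_succ] using hR⟩
  rcases h : l.reverse with _ | ⟨b, m⟩
  · exact ⟨[], rfl⟩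
  · exact key m

/-- Encoding the reversed sequence: in the reversed encoding, the zeros which ended the numbers
stand in front of them. -/
theorem unaryWord_reverse (R : List ℕ) :
    unaryWord R.reverse = ((unaryWord R).reverse ++ [false]).tail := by
  have key : ∀ R : List ℕ, false :: unaryWord R.reverse = (unaryWord R).reverse ++ [false] := by
    intro R
    induction R with
    | nil => rfl
    | cons r R ih =>
      have happ : unaryWord (R.reverse ++ [r]) = unaryWord R.reverse ++ unaryWord [r] := by
        simp [unaryWord]
      rw [List.reverse_cons, happ, ← List.cons_append, ih]
      simp
  rw [← key, List.tail_cons]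

/-- The pairs `((w, l), y)` such that the bits of `y` lead, from the sequence encoded by `l`, to a
sequence `α` and a sign `s`, with the rest `y'` of `y` and `(w, α)` forming a pair in `L s`. -/
def raiseLang (mg : Bool) (L : Bool → Set (List Bool)) : Set (List Bool) :=
  {z | ∃ w l y R, z = pairWord (pairWord w l) y ∧ unaryWord R = (l.reverse ++ [false]).tail ∧
    ∃ α s y', (coreTree mg R).run y = some ((α, s), y') ∧
      pairWord (pairWord w (unaryWord α)) y' ∈ L s}

theorem mem_raiseLang {mg : Bool} {L : Bool → Set (List Bool)} {w l y : List Bool} {R : List ℕ}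
    (hR : unaryWord R = (l.reverse ++ [false]).tail) :
    pairWord (pairWord w l) y ∈ raiseLang mg L ↔
    ∃ α s y', (coreTree mg R).run y = some ((α, s), y') ∧
      pairWord (pairWord w (unaryWord α)) y' ∈ L s := by
  constructor
  · rintro ⟨w', l', y', R', h, hR', h'⟩
    obtain ⟨h1, rfl⟩ := pairWord_injective h
    obtain ⟨rfl, rfl⟩ := pairWord_injective h1
    rw [← hR] at hR'
    rwa [unaryWord_injective hR'] at h'
  · exact fun h => ⟨w, l, y, R, rfl, hR, h⟩

namespace RaiseLab

variable {mg : Bool}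

/-- From the reading of the rows to the writing of the resulting sequence, the program carries
out `coreTree`. -/
theorem gets_core (l y : List Bool) (R : List ℕ)
    (hR : unaryWord R = (l.reverse ++ [false]).tail) (o : List Bool) :
    Gets mg (6 * l.length ^ 2 + 8 * l.length + 3) dropTop
      (stk y o (l.reverse ++ [false]) [] [] [])
      (((coreTree mg R).run y).map fun r => (rest r.1.2,
        stk r.2 (false :: ((dbl (unaryWord r.1.1)).reverse ++ o)) [] [] [] [])) := by
  have hN : (unaryWord R).length = l.length := by simp [hR]
  have hRl := length_le_unaryWord R
  rw [hN] at hRl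
  have h1 : Gets mg (R.length * (6 * l.length + 6) + 1) (row false)
      (stk y o (unaryWord R) (unaryWord []) [] []) _ :=
    gets_rows l.length R [] false y o (by simp [hN])
  refine .mono (n := (R.length * (6 * l.length + 6) + 1) + (2 * l.length + 1) + 1)
    (.step (q' := row false) (stk y o (unaryWord R) [] [] []) ?_ ?_) ?_
  · rw [hR]
    simp [next'_eq, next, scan, StackProgram.pushAll]
  · have h2 := Gets.bind h1 (m := 2 * l.length + 1) (g := fun r =>
      (((finTree mg r.1.1).run r.2).map fun x => (rest r.1.2,
        stk x.2 (false :: ((dbl (unaryWord x.1)).reverse ++ o)) [] [] [] []))) ?_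
    · change Gets mg _ _ (stk y o (unaryWord R) (unaryWord []) [] []) _
      convert h2 using 1
      unfold coreTree
      rw [BitTree.run_bind, Option.map_bind]
      congr 1
      funext r
      simp only [Function.comp_def, BitTree.run_map, Option.map_map]
    · intro r hr
      have := rowsTree_leaves (BitTree.mem_leaves_of_run hr)
      rw [unaryWord_nil, List.length_nil, add_zero, hN] at this
      rw [← this]
      exact gets_skip _ _ _ _
  · have := Nat.mul_le_mul_right (6 * l.length + 6) hRl
    nlinarith

end RaiseLab

open RaiseLab in
/-- The program decides `raiseLang`, with the decision problems `L s` as exits. -/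
theorem polyTimeDecidable_raiseLang (mg : Bool) {L : Bool → Set (List Bool)}
    (hL : ∀ s, PolyTimeDecidable (L s)) : PolyTimeDecidable (raiseLang mg L) := by
  let τ : ℕ → ℕ := fun n => 6 * n ^ 2 + 10 * n + 5
  let p : Polynomial ℕ := .C 5 * (.C 6 * .X ^ 2 + .C 10 * .X + .C 5) + .X + .C 6
  have hp : ∀ n, p.eval n = 5 * τ n + n + 6 := by intro n; simp [p, τ]
  have hstart : ∀ x, Function.update (fun _ => []) Stk.inp x = stk x [] [] [] [] [] := by
    intro x; rw [nil_eq_stk, stk.update_inp]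
  have hend : ∀ x, Function.update (fun _ => []) Stk.out x = stk [] x [] [] [] [] := by
    intro x; rw [nil_eq_stk, stk.update_out]
  -- failing runs end with the clearing of the stacks
  have hfail : ∀ (x : List Bool), Gets mg (τ x.length) pair0 (stk x [] [] [] [] []) none →
      (raiseProgram mg).Run (p.eval x.length)
      (.inl pair0, Function.update (fun _ => []) Stk.inp x) (.inr none, fun _ => []) := by
    rintro x ⟨T, h⟩
    rw [hstart]
    refine (h.trans (run_clean T)).mono ?_
    have h1 := h.sum_length_le (raiseProgram_next_length mg)
    have h2 : ∑ s, (stk x [] [] [] [] [] s).length = x.length := by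
      change ∑ s ∈ ({.inp, .out, .a, .b, .c, .d} : Finset Stk), _ = _
      simp
    simp only [h2] at h1
    rw [hp]
    omega
  -- the run on an encoded pair, up to the copying of the rest of `y`
  have hcore : ∀ (w l y : List Bool) (R : List ℕ),
      unaryWord R = (l.reverse ++ [false]).tail →
      Gets mg (τ (pairWord (pairWord w l) y).length - (pairWord (pairWord w l) y).length - 1) pair0
        (stk (pairWord (pairWord w l) y) [] [] [] [] [])
        (((coreTree mg R).run y).map fun r => (rest r.1.2,
        stk r.2 (false :: ((dbl (unaryWord r.1.1)).reverse ++ ((pairHead w).reverse ++ [])))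
          [] [] [] [])) := by
    intro w l y R hR
    have h : Gets mg ((pairWord (pairWord w l) y).length + 1) pair0
        (stk (pairWord (pairWord w l) y) [] [] [] [] [])
        (some (dropTop, stk y ((pairHead w).reverse ++ []) (l.reverse ++ [false]) [] [] [])) := by
      rcases gets_pair (mg := mg) (pairWord (pairWord w l) y) [] with
        ⟨w', l', y', hx, h⟩ | ⟨hx, -⟩
      · obtain ⟨hx', rfl⟩ := pairWord_injective hx
        obtain ⟨rfl, rfl⟩ := pairWord_injective hx'
        exact h
      · exact absurd rfl (hx w l y)
    refine (h.trans (gets_core l y R hR _)).mono ?_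
    have hl : l.length ≤ (pairWord (pairWord w l) y).length := by
      rw [pairWord_pairWord]
      have : l.length ≤ (dbl l).length := by
        simp [dbl]
        omega
      simp only [List.length_append]
      omega
    have := Nat.pow_le_pow_left hl 2
    simp only [τ]
    omega
  have hok : ∀ (w l y : List Bool) (R : List ℕ),
      unaryWord R = (l.reverse ++ [false]).tail → ∀ α s y',
      (coreTree mg R).run y = some ((α, s), y') →
      (raiseProgram mg).Run (p.eval (pairWord (pairWord w l) y).length)
      (.inl pair0, Function.update (fun _ => []) Stk.inp (pairWord (pairWord w l) y))
      (.inr (some s), Function.update (fun _ => []) Stk.out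
        (pairWord (pairWord w (unaryWord α)) y').reverse) := by
    intro w l y R hR α s y' hr
    have h1 := hcore w l y R hR
    rw [hr] at h1
    have h2 := StackProgram.Run.trans h1 (run_rest s y'
      (false :: ((dbl (unaryWord α)).reverse ++ ((pairHead w).reverse ++ []))))
    rw [hstart, hend]
    convert h2.mono ?_ using 4
    · rw [pairWord_pairWord]; simp
    · have h3 := (BitTree.length_le_of_run hr).2
      have h4 : y.length ≤ (pairWord (pairWord w l) y).length := by
        rw [pairWord_pairWord]; simp; omega
      rw [hp]
      simp only [τ]
      omega
  refine StackProgram.polyTimeDecidable (P := raiseProgram mg) (raiseProgram_next_length mg) true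
    .inp .out hL p _ ?_ ?_
  · intro x hx
    rcases gets_pair (mg := mg) x [] with ⟨w, l, y, rfl, -⟩ | ⟨-, h⟩
    · obtain ⟨R, hR⟩ := exists_unaryWord_eq_tail l
      rw [mem_raiseLang hR] at hx
      rcases hr : (coreTree mg R).run y with _ | ⟨⟨α, s⟩, y'⟩
      · have h1 := hcore w l y R hR
        rw [hr] at h1
        exact .inl (hfail _ (h1.mono (by omega)))
      · exact .inr ⟨s, _, fun hmem => hx ⟨α, s, y', hr, hmem⟩, hok w l y R hR α s y' hr⟩
    · exact .inl (hfail x (h.mono (by simp only [τ]; omega)))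
  · rintro x ⟨w, l, y, R, rfl, hR, α, s, y', hr, hmem⟩
    exact ⟨s, _, hmem, hok w l y R hR α s y' hr⟩

/-! ### Closure of `GapP` under signed sums over raisings and mergings -/

theorem length_pairWord (u v : List Bool) :
    (pairWord u v).length = 2 * u.length + v.length + 1 := by
  simp [pairWord]
  omega

/-- `#P` is closed under sums over the leaves of `coreTree`: a witness is the path to a leaf,
followed by a witness for this leaf. -/
theorem inSharpP_raise (mg : Bool) {g : Bool → List Bool → ℕ} (hg : ∀ s, InSharpP (g s)) :
    ∃ g' : List Bool → ℕ, InSharpP g' ∧ ∀ w l, g' (pairWord w (unaryWord l)) =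
      ((coreTree mg l.reverse).leaves.map fun x => g x.2 (pairWord w (unaryWord x.1))).sum := by
  choose L hL p hp hgL using hg
  have hfin : ∀ s x, {u | pairWord x u ∈ L s}.Finite := fun s x =>
    (List.finite_length_le Bool ((p s).eval x.length)).subset fun u hu => hp s x u hu
  refine ⟨fun x => {u | pairWord x u ∈ raiseLang mg L}.ncard,
    ⟨_, polyTimeDecidable_raiseLang mg hL, p false + p true + .X ^ 2 + .X, ?_, fun _ => rfl⟩, ?_⟩
  · rintro x y ⟨w, l, y, R, h, hR, α, s, y', hr, hmem⟩
    obtain ⟨rfl, rfl⟩ := pairWord_injective h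
    have h1 := (BitTree.length_le_of_run hr).1
    have h2 := coreTree_height mg R
    have h3 := coreTree_leaves (BitTree.mem_leaves_of_run hr)
    have hRl : (unaryWord R).length = l.length := by simp [hR]
    rw [hRl] at h2 h3
    have h4 := hp s _ _ hmem
    have h5 : (p s).eval (pairWord w (unaryWord α)).length ≤ (p s).eval (pairWord w l).length :=
      (p s).eval_mono_nat (by simp only [length_pairWord] at *; omega)
    have h6 : (p s).eval (pairWord w l).length ≤
        (p false).eval (pairWord w l).length + (p true).eval (pairWord w l).length := by
      cases s <;> omega
    have h7 : l.length ≤ (pairWord w l).length := by rw [length_pairWord]; omega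
    have h8 := Nat.pow_le_pow_left h7 2
    simp only [Polynomial.eval_add, Polynomial.eval_pow, Polynomial.eval_X]
    omega
  · intro w l
    have h1 : {u | pairWord (pairWord w (unaryWord l)) u ∈ raiseLang mg L} =
        {y | ∃ x y', (coreTree mg l.reverse).run y = some (x, y') ∧
          y' ∈ {u | pairWord (pairWord w (unaryWord x.1)) u ∈ L x.2}} := by
      ext y
      rw [Set.mem_ofPred_eq, mem_raiseLang (unaryWord_reverse l)]
      simp
    have h2 : ∀ x : List ℕ × Bool, {u | pairWord (pairWord w (unaryWord x.1)) u ∈ L x.2}.encard =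
        (g x.2 (pairWord w (unaryWord x.1)) : ℕ∞) := by
      intro x
      rw [hgL, (hfin _ _).cast_ncard_eq]
    simp only
    rw [h1, Set.ncard, BitTree.encard_run]
    simp only [h2]
    generalize (coreTree mg l.reverse).leaves = M
    have h3 : (M.map fun x => (g x.2 (pairWord w (unaryWord x.1)) : ℕ∞)).sum =
        (((M.map fun x => g x.2 (pairWord w (unaryWord x.1))).sum : ℕ) : ℕ∞) := by
      induction M with
      | nil => simp
      | cons a M ih => simp [ih]
    rw [h3, ENat.toNat_natCast]

/-- `GapP` is closed under signed sums over the leaves of `coreTree`. For a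
difference `g - h` of counting functions, `g` at the leaves with sign `1` and `h` at those with sign
`-1` are counted together, and vice versa. -/
theorem inGapP_raise (mg : Bool) {f : List Bool → ℤ} (hf : InGapP f) :
    ∃ f' : List Bool → ℤ, InGapP f' ∧ ∀ w l, f' (pairWord w (unaryWord l)) =
      ((coreTree mg l.reverse).leaves.map fun x =>
        (if x.2 then -1 else 1) * f (pairWord w (unaryWord x.1))).sum := by
  obtain ⟨g, h, hg, hh, hfgh⟩ := hf
  obtain ⟨g', hg', hg1⟩ := inSharpP_raise mg (g := fun s => if s then h else g)
    (by intro s; cases s <;> simpa)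
  obtain ⟨h', hh', hh1⟩ := inSharpP_raise mg (g := fun s => if s then g else h)
    (by intro s; cases s <;> simpa)
  refine ⟨fun x => g' x - h' x, ⟨g', h', hg', hh', fun _ => rfl⟩, fun w l => ?_⟩
  simp only [hg1, hh1]
  generalize (coreTree mg l.reverse).leaves = M
  induction M with
  | nil => simp
  | cons a M ih =>
    rw [List.map_cons, List.map_cons, List.map_cons, List.sum_cons, List.sum_cons, List.sum_cons,
      ← ih, hfgh]
    push_cast
    rcases a with ⟨a, _ | _⟩
    · simp only [Bool.false_eq_true, if_false]; ring
    · simp only [if_true]; ring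

/-! ### Alternants and semistandard tableaux -/

section Alternants

open Finset Matrix

/-- The alternant `det (x_i ^ (lam_j + n - 1 - j))`. -/
def alternant {R : Type*} [CommRing R] {n : ℕ} (x : ℕ → R) (lam : Fin n → ℕ) : R :=
  (Matrix.of fun i j : Fin n => x i ^ (lam j + (n - 1 - j))).det

/-- The product of the differences `x_i - x_j` with `i < j < n`. -/
def vprod {R : Type*} [CommRing R] (n : ℕ) (x : ℕ → R) : R :=
  ∏ j ∈ range n, ∏ i ∈ range j, (x i - x j)

/-- The sequences `mu` interlacing with `lam`. -/
def interlacing {n : ℕ} (lam : Fin (n + 1) → ℕ) : Finset (Fin n → ℕ) :=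
  Fintype.piFinset fun i => Icc (lam i.succ) (lam i.castSucc)

theorem pow_sub_pow_mul_eq {R : Type*} [CommRing R] (y t : R) {a b : ℕ} (hab : a ≤ b) (k : ℕ) :
    y ^ (b + k + 1) - t ^ (b - a + 1) * y ^ (a + k) =
      (y - t) * ∑ m ∈ Icc a b, t ^ (b - m) * y ^ (m + k) := by
  induction b, hab using Nat.le_induction with
  | base => simp; ring
  | succ b hab ih =>
    rw [sum_Icc_succ_top (by omega), sum_congr rfl (g := fun m => t * (t ^ (b - m) * y ^ (m + k))),
      ← mul_sum, mul_add, mul_left_comm, ← ih, show b + 1 - a + 1 = (b - a + 1) + 1 by omega]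
    · simp; ring
    · intro m hm
      rw [mem_Icc] at hm
      rw [show b + 1 - m = b - m + 1 by omega]
      ring

/-- The determinant is multilinear in the columns. -/
theorem det_of_sum {R : Type*} [CommRing R] {n : ℕ} (A : Fin n → Finset ℕ)
    (c : Fin n → ℕ → R) (f : Fin n → Fin n → ℕ → R) :
    (Matrix.of fun i j => ∑ m ∈ A j, c j m * f i j m).det =
      ∑ mu ∈ Fintype.piFinset A, (∏ j, c j (mu j)) * (Matrix.of fun i j => f i j (mu j)).det := by
  simp only [det_apply', of_apply, prod_univ_sum, mul_sum]
  rw [sum_comm]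
  refine sum_congr rfl fun mu _ => sum_congr rfl fun s _ => ?_
  rw [prod_mul_distrib]
  ring

/-- The branching rule for alternants: the last variable splits off, and the remaining alternants
belong to the sequences interlacing with `lam`. -/
theorem alternant_succ {R : Type*} [CommRing R] {n : ℕ} (x : ℕ → R) (lam : Fin (n + 1) → ℕ)
    (hlam : Antitone lam) :
    alternant x lam = (∏ i ∈ range n, (x i - x n)) * (x n ^ lam (Fin.last n) *
      ∑ mu ∈ interlacing lam, (∏ i, x n ^ (lam i.castSucc - mu i)) * alternant x mu) := by
  have hr : ∀ i : Fin n, lam i.succ ≤ lam i.castSucc := fun i => hlam i.castSucc_le_succ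
  -- Column operations make all but one entry of the last row zero.
  let A : Matrix (Fin (n + 1)) (Fin (n + 1)) R :=
    Matrix.of fun i j => x i ^ (lam j + (n - j))
  let c : Fin n → R := fun j => x n ^ (lam j.castSucc - lam j.succ + 1)
  let B : Matrix (Fin (n + 1)) (Fin (n + 1)) R := Matrix.of fun i j =>
    Fin.lastCases (motive := fun _ => R) (A i (Fin.last n))
      (fun j => A i j.castSucc - c j * A i j.succ) j
  have hAB : A.det = B.det := by
    rw [← det_submatrix_equiv_self Fin.revPerm A, ← det_submatrix_equiv_self Fin.revPerm B]
    refine det_eq_of_forall_col_eq_smul_add_pred (fun j => c j.rev) ?_ ?_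
    · intro i
      simp [B]
    · intro i j
      simp [B, Fin.rev_succ, Fin.rev_castSucc]
  have hB : ∀ (i j : Fin n), B i.castSucc j.castSucc = (x i - x n) *
      ∑ m ∈ Icc (lam j.succ) (lam j.castSucc),
        x n ^ (lam j.castSucc - m) * x i ^ (m + (n - 1 - j)) := by
    intro i j
    rw [← pow_sub_pow_mul_eq _ _ (hr j)]
    have : n - j = n - 1 - j + 1 := by omega
    have h2 : n - (j + 1) = n - 1 - j := by omega
    simp [B, A, c, this, h2, add_assoc]
  have hB0 : ∀ j : Fin n, B (Fin.last n) j.castSucc = 0 := by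
    intro j
    have : lam j.castSucc + (n - j) =
      (lam j.castSucc - lam j.succ + 1) + (lam j.succ + (n - (j + 1))) := by
      have := hr j
      omega
    simp only [B, A, c, of_apply, Fin.lastCases_castSucc, Fin.val_last, Fin.val_castSucc,
      Fin.val_succ]
    rw [← pow_add, ← this, sub_self]
  have hBl : B (Fin.last n) (Fin.last n) = x n ^ lam (Fin.last n) := by simp [B, A]
  have hdet : B.det = x n ^ lam (Fin.last n) * (B.submatrix Fin.castSucc Fin.castSucc).det := by
    rw [det_succ_row B (Fin.last n), Fin.sum_univ_castSucc]
    simp [hB0, hBl, Fin.succAbove_last, ← two_mul]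
  have halt : alternant x lam = A.det := by
    simp [alternant, A]
  have hsub : B.submatrix Fin.castSucc Fin.castSucc = Matrix.of fun i j : Fin n => (x i - x n) *
      (Matrix.of fun i j : Fin n => ∑ m ∈ Icc (lam j.succ) (lam j.castSucc),
        x n ^ (lam j.castSucc - m) * x i ^ (m + (n - 1 - j))) i j := by
    ext i j
    simp [hB]
  rw [halt, hAB, hdet, hsub, det_mul_column, det_of_sum _ (fun j m => x n ^ (lam j.castSucc - m))
    (fun i j m => x i ^ (m + (n - 1 - j))), ← Fin.prod_univ_eq_prod_range]
  rw [mul_left_comm]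
  rfl

end Alternants

section Tableaux

open Finset

/-- The length of the `i`-th row, as a function on `ℕ`. -/
def rowLength {n : ℕ} (lam : Fin n → ℕ) (i : ℕ) : ℕ := if h : i < n then lam ⟨i, h⟩ else 0

theorem rowLength_of_le {n : ℕ} (lam : Fin n → ℕ) {i : ℕ} (h : n ≤ i) : rowLength lam i = 0 :=
  dif_neg (by omega)

@[simp] theorem rowLength_coe {n : ℕ} (lam : Fin n → ℕ) (i : Fin n) : rowLength lam i = lam i :=
  dif_pos i.2

theorem rowLength_antitone {n : ℕ} {lam : Fin n → ℕ} (h : Antitone lam) :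
    Antitone (rowLength lam) := by
  intro i j hij
  by_cases hj : j < n
  · rw [rowLength, rowLength, dif_pos hj, dif_pos (by omega)]
    exact h hij
  · rw [rowLength_of_le _ (by omega)]
    exact Nat.zero_le _

/-- `T` is a semistandard tableau of shape `lam` with entries less than `n`. Outside the shape it is
zero, so that tableaux are determined by their entries. -/
structure IsTableau {n : ℕ} (lam : Fin n → ℕ) (T : ℕ → ℕ → ℕ) : Prop where
  row_weak : ∀ i j₁ j₂, j₁ < j₂ → j₂ < rowLength lam i → T i j₁ ≤ T i j₂
  col_strict : ∀ i₁ i₂ j, i₁ < i₂ → j < rowLength lam i₂ → T i₁ j < T i₂ j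
  zeros : ∀ i j, rowLength lam i ≤ j → T i j = 0
  lt : ∀ i j, j < rowLength lam i → T i j < n

/-- Filling the cells of `lam` outside `mu` by `n`. -/
def extendTableau {n : ℕ} (lam : Fin (n + 1) → ℕ) (mu : Fin n → ℕ) (T : ℕ → ℕ → ℕ) : ℕ → ℕ → ℕ :=
  fun i j => if j < rowLength mu i then T i j else if j < rowLength lam i then n else 0

open Classical in
/-- The semistandard tableaux of shape `lam` with entries less than `n`, built by adding the cells
with the largest entry. -/
noncomputable def tableaux : ∀ {n : ℕ}, (Fin n → ℕ) → Finset (ℕ → ℕ → ℕ)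
  | 0, _ => {fun _ _ => 0}
  | _ + 1, lam => (interlacing lam).biUnion fun mu => (tableaux mu).image (extendTableau lam mu)

section Interlacing

variable {n : ℕ} {lam : Fin (n + 1) → ℕ} {mu : Fin n → ℕ}

theorem rowLength_le_of_interlacing (h : mu ∈ interlacing lam) (i : ℕ) :
    rowLength mu i ≤ rowLength lam i := by
  by_cases hi : i < n
  · have := (mem_Icc.1 (Fintype.mem_piFinset.1 h ⟨i, hi⟩)).2
    rw [rowLength, dif_pos hi, rowLength, dif_pos (by omega)]
    exact this
  · rw [rowLength_of_le _ (by omega)]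
    exact Nat.zero_le _

theorem rowLength_succ_le_of_interlacing (h : mu ∈ interlacing lam) (i : ℕ) :
    rowLength lam (i + 1) ≤ rowLength mu i := by
  by_cases hi : i < n
  · have := (mem_Icc.1 (Fintype.mem_piFinset.1 h ⟨i, hi⟩)).1
    rw [rowLength, dif_pos (by omega), rowLength, dif_pos hi]
    exact this
  · rw [rowLength_of_le _ (by omega)]
    exact Nat.zero_le _

theorem antitone_of_interlacing (hlam : Antitone lam) (h : mu ∈ interlacing lam) :
    Antitone mu := by
  intro i j hij
  rcases hij.eq_or_lt with rfl | hij
  · exact le_rfl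
  · have h1 := (mem_Icc.1 (Fintype.mem_piFinset.1 h j)).2
    have h2 := (mem_Icc.1 (Fintype.mem_piFinset.1 h i)).1
    exact h1.trans ((hlam (show i.succ ≤ j.castSucc from hij)).trans h2)

theorem IsTableau.extend (hlam : Antitone lam) (h : mu ∈ interlacing lam) {T : ℕ → ℕ → ℕ}
    (hT : IsTableau mu T) : IsTableau lam (extendTableau lam mu T) where
  row_weak i j₁ j₂ hj hj₂ := by
    simp only [extendTableau]
    by_cases h2 : j₂ < rowLength mu i
    · rw [if_pos h2, if_pos (hj.trans h2)]
      exact hT.row_weak i j₁ j₂ hj h2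
    · rw [if_neg h2, if_pos hj₂]
      split_ifs with h1
      · exact (hT.lt i j₁ h1).le
      · exact le_rfl
      · exact Nat.zero_le _
  col_strict i₁ i₂ j hi hj := by
    have h1 : j < rowLength mu i₁ := hj.trans_le
      ((rowLength_antitone hlam (Nat.succ_le_of_lt hi)).trans
        (rowLength_succ_le_of_interlacing h i₁))
    simp only [extendTableau]
    rw [if_pos h1]
    by_cases h2 : j < rowLength mu i₂
    · rw [if_pos h2]
      exact hT.col_strict i₁ i₂ j hi h2
    · rw [if_neg h2, if_pos hj]
      exact hT.lt i₁ j h1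
  zeros i j hj := by
    have := rowLength_le_of_interlacing h i
    simp only [extendTableau]
    rw [if_neg (by omega), if_neg (by omega)]
  lt i j hj := by
    simp only [extendTableau]
    split_ifs with h1
    · exact (hT.lt i j h1).trans (Nat.lt_succ_self n)
    · exact Nat.lt_succ_self n

theorem extendTableau_lt_iff (h : mu ∈ interlacing lam) {T : ℕ → ℕ → ℕ} (hT : IsTableau mu T)
    (i j : ℕ) : j < rowLength mu i ↔ j < rowLength lam i ∧ extendTableau lam mu T i j < n := by
  have := rowLength_le_of_interlacing h i
  simp only [extendTableau]
  constructor
  · intro hj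
    rw [if_pos hj]
    exact ⟨by omega, hT.lt i j hj⟩
  · rintro ⟨h1, h2⟩
    by_contra hj
    rw [if_neg hj, if_pos h1] at h2
    omega

theorem exists_initial_segment (f : ℕ → ℕ) (n L : ℕ)
    (h : ∀ j₁ j₂, j₁ < j₂ → j₂ < L → f j₁ ≤ f j₂) :
    ∃ m ≤ L, ∀ j < L, f j < n ↔ j < m := by
  induction L with
  | zero => exact ⟨0, le_rfl, fun j hj => absurd hj (by omega)⟩
  | succ L ih =>
    obtain ⟨m, hm, hmj⟩ := ih fun j₁ j₂ h1 h2 => h j₁ j₂ h1 (by omega)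
    by_cases hL : f L < n
    · refine ⟨L + 1, le_rfl, fun j hj => ⟨fun _ => hj, fun _ => ?_⟩⟩
      rcases (Nat.lt_succ_iff.1 hj).eq_or_lt with rfl | hj
      · exact hL
      · exact (h j L hj (by omega)).trans_lt hL
    · refine ⟨m, by omega, fun j hj => ?_⟩
      rcases (Nat.lt_succ_iff.1 hj).eq_or_lt with rfl | hj
      · exact ⟨fun hh => absurd hh hL, fun hh => absurd hh (by omega)⟩
      · exact hmj j hj

/-- Every tableau arises by extension: the cells with entries less than `n` form a tableau of an
interlacing shape. -/
theorem IsTableau.exists_extend {T : ℕ → ℕ → ℕ} (hlam : Antitone lam) (hT : IsTableau lam T) :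
    ∃ mu ∈ interlacing lam, ∃ T', IsTableau mu T' ∧ extendTableau lam mu T' = T := by
  have hanti := rowLength_antitone hlam
  choose mu hmu hmuj using fun i : Fin n =>
    exists_initial_segment (T i) n (lam i.castSucc) fun j₁ j₂ h1 h2 =>
      hT.row_weak i j₁ j₂ h1 (by rw [← Fin.val_castSucc, rowLength_coe]; exact h2)
  have hrl : ∀ i : Fin n, rowLength lam i = lam i.castSucc := fun i => rowLength_coe lam i.castSucc
  have hrls : ∀ i : Fin n, rowLength lam (i + 1) = lam i.succ := fun i => rowLength_coe lam i.succ
  have hinter : mu ∈ interlacing lam := by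
    refine Fintype.mem_piFinset.2 fun i => mem_Icc.2 ⟨?_, hmu i⟩
    by_contra hlt
    push Not at hlt
    have h1 : mu i < lam i.castSucc := hlt.trans_le (hlam i.castSucc_le_succ)
    have h2 := (hmuj i _ h1).not.2 (lt_irrefl _)
    have h3 : mu i < rowLength lam (i + 1) := by rw [hrls]; exact hlt
    have h4 := hT.col_strict i (i + 1) (mu i) (Nat.lt_succ_self _) h3
    have h5 := hT.lt (i + 1) (mu i) h3
    omega
  have hle := rowLength_le_of_interlacing hinter
  have hlt : ∀ i j, j < rowLength mu i → T i j < n := by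
    intro i j hj
    by_cases hi : i < n
    · have h1 : j < mu ⟨i, hi⟩ := by rwa [rowLength, dif_pos hi] at hj
      exact (hmuj ⟨i, hi⟩ j (h1.trans_le (hmu _))).2 h1
    · rw [rowLength_of_le _ (by omega)] at hj
      omega
  -- the entries of the `i`-th row are at least `i`
  have hge : ∀ i j, j < rowLength lam i → i ≤ T i j := by
    intro i
    induction i with
    | zero => intro j _; exact Nat.zero_le _
    | succ i ih =>
      intro j hj
      have h1 := ih j (hj.trans_le (hanti (Nat.le_succ i)))
      have h2 := hT.col_strict i (i + 1) j (Nat.lt_succ_self i) hj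
      omega
  refine ⟨mu, hinter, fun i j => if j < rowLength mu i then T i j else 0, ⟨?_, ?_, ?_, ?_⟩, ?_⟩
  · intro i j₁ j₂ hj hj₂
    simp only [if_pos hj₂, if_pos (hj.trans hj₂)]
    exact hT.row_weak i j₁ j₂ hj (hj₂.trans_le (hle i))
  · intro i₁ i₂ j hi hj
    have := rowLength_antitone (antitone_of_interlacing hlam hinter) hi.le
    simp only [if_pos hj, if_pos (hj.trans_le this)]
    exact hT.col_strict i₁ i₂ j hi (hj.trans_le (hle i₂))
  · intro i j hj
    simp only [if_neg (not_lt.2 hj)]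
  · intro i j hj
    simp only [if_pos hj]
    exact hlt i j hj
  · funext i j
    simp only [extendTableau]
    split_ifs with h1 h2
    · rfl
    · have h3 := hT.lt i j h2
      by_cases hi : i < n
      · rw [rowLength, dif_pos hi] at h1
        have := (hmuj ⟨i, hi⟩ j (by rw [← hrl]; exact h2)).not.2 h1
        simp only at this
        omega
      · have := hge i j h2
        omega
    · exact (hT.zeros i j (by omega)).symm

end Interlacing

theorem mem_tableaux {n : ℕ} {lam : Fin n → ℕ} (hlam : Antitone lam) {T : ℕ → ℕ → ℕ} :
    T ∈ tableaux lam ↔ IsTableau lam T := by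
  induction n generalizing T with
  | zero =>
    rw [tableaux, mem_singleton]
    constructor
    · rintro rfl
      exact ⟨by simp, by simp [rowLength], by simp, by simp [rowLength]⟩
    · intro h
      funext i j
      exact h.zeros i j (by simp [rowLength])
  | succ n ih =>
    simp only [tableaux, mem_biUnion, mem_image]
    constructor
    · rintro ⟨mu, hmu, T', hT', rfl⟩
      exact ((ih (antitone_of_interlacing hlam hmu)).1 hT').extend hlam hmu
    · intro h
      obtain ⟨mu, hmu, T', hT', rfl⟩ := h.exists_extend hlam
      exact ⟨mu, hmu, T', (ih (antitone_of_interlacing hlam hmu)).2 hT', rfl⟩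

theorem sum_tableaux_succ {R : Type*} [AddCommMonoid R] {n : ℕ} {lam : Fin (n + 1) → ℕ}
    (hlam : Antitone lam) (f : (ℕ → ℕ → ℕ) → R) : ∑ T ∈ tableaux lam, f T =
      ∑ mu ∈ interlacing lam, ∑ T ∈ tableaux mu, f (extendTableau lam mu T) := by
  classical
  rw [tableaux, sum_biUnion]
  · refine sum_congr rfl fun mu hmu => ?_
    rw [sum_image]
    intro T hT T' hT' h
    have hT := (mem_tableaux (antitone_of_interlacing hlam hmu)).1 hT
    have hT' := (mem_tableaux (antitone_of_interlacing hlam hmu)).1 hT'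
    funext i j
    by_cases hj : j < rowLength mu i
    · simpa [extendTableau, hj] using congrFun (congrFun h i) j
    · rw [hT.zeros i j (by omega), hT'.zeros i j (by omega)]
  · intro mu hmu mu' hmu' hne
    refine disjoint_left.2 fun T hT hT' => hne ?_
    simp only [mem_image] at hT hT'
    obtain ⟨T, hT, rfl⟩ := hT
    obtain ⟨T', hT', h⟩ := hT'
    have hT := (mem_tableaux (antitone_of_interlacing hlam hmu)).1 hT
    have hT' := (mem_tableaux (antitone_of_interlacing hlam hmu')).1 hT'
    funext i
    rw [← rowLength_coe mu, ← rowLength_coe mu']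
    refine eq_of_forall_lt_iff fun j => ?_
    rw [extendTableau_lt_iff hmu hT, extendTableau_lt_iff hmu' hT', h]

/-- The product of the variables at the entries of a tableau. -/
def tableauWeight {R : Type*} [CommRing R] {n : ℕ} (x : ℕ → R) (lam : Fin n → ℕ)
    (T : ℕ → ℕ → ℕ) : R :=
  ∏ i : Fin n, ∏ j ∈ range (lam i), x (T i j)

theorem tableauWeight_extend {R : Type*} [CommRing R] {n : ℕ} (x : ℕ → R)
    {lam : Fin (n + 1) → ℕ} {mu : Fin n → ℕ} (h : mu ∈ interlacing lam) (T : ℕ → ℕ → ℕ) :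
    tableauWeight x lam (extendTableau lam mu T) = x n ^ lam (Fin.last n) *
      ((∏ i, x n ^ (lam i.castSucc - mu i)) * tableauWeight x mu T) := by
  rw [tableauWeight, Fin.prod_univ_castSucc, mul_comm, tableauWeight, ← prod_mul_distrib]
  congr 1
  · rw [prod_congr rfl (g := fun _ => x n)]
    · simp
    · intro j hj
      rw [mem_range] at hj
      rw [extendTableau, if_neg, if_pos]
      · rwa [rowLength_coe]
      · rw [rowLength_of_le _ (by simp)]
        omega
  · refine prod_congr rfl fun i _ => ?_
    have hle := (mem_Icc.1 (Fintype.mem_piFinset.1 h i)).2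
    rw [← prod_range_mul_prod_Ico _ hle, mul_comm]
    congr 1
    · rw [prod_congr rfl (g := fun _ => x n)]
      · simp
      · intro j hj
        rw [mem_Ico] at hj
        rw [extendTableau, if_neg, if_pos]
        · rw [rowLength_coe]; exact hj.2
        · rw [Fin.val_castSucc, rowLength_coe]; omega
    · refine prod_congr rfl fun j hj => ?_
      rw [mem_range] at hj
      rw [extendTableau, if_pos]
      · rfl
      · rwa [Fin.val_castSucc, rowLength_coe]

/-- The bialternant formula for the generating function of tableaux. -/
theorem alternant_eq {R : Type*} [CommRing R] {n : ℕ} (x : ℕ → R) {lam : Fin n → ℕ}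
    (hlam : Antitone lam) :
    alternant x lam = vprod n x * ∑ T ∈ tableaux lam, tableauWeight x lam T := by
  induction n with
  | zero => simp [alternant, vprod, tableaux, tableauWeight]
  | succ n ih =>
    rw [alternant_succ x lam hlam, sum_tableaux_succ hlam, vprod, prod_range_succ, ← vprod]
    simp only [mul_sum]
    refine sum_congr rfl fun mu hmu => ?_
    rw [ih (antitone_of_interlacing hlam hmu)]
    simp only [mul_sum]
    refine sum_congr rfl fun T _ => ?_
    rw [tableauWeight_extend x hmu]
    ring

end Tableaux

/-! ### Expansions into Schur polynomials -/

section SchurExpansion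

open Finset MvPolynomial

variable {n : ℕ}

/-- The variables as a sequence indexed by `ℕ`, extended by zero. -/
noncomputable def xvar (n : ℕ) : ℕ → MvPolynomial (Fin n) ℂ := fun i =>
  if h : i < n then X ⟨i, h⟩ else 0

@[simp] theorem xvar_coe (i : Fin n) : xvar n i = X i := dif_pos i.2

/-- The exponent vector with given entries. -/
noncomputable def expo (a : Fin n → ℕ) : Fin n →₀ ℕ := Finsupp.equivFunOnFinite.symm a

@[simp] theorem expo_apply (a : Fin n → ℕ) (i : Fin n) : expo a i = a i := rfl

theorem expo_inj {a b : Fin n → ℕ} : expo a = expo b ↔ a = b :=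
  Finsupp.equivFunOnFinite.symm.injective.eq_iff

theorem expo_coe (e : Fin n →₀ ℕ) : expo e = e := by ext; rfl

theorem prod_X_pow_eq_monomial_expo (a : Fin n → ℕ) :
    ∏ i, (X i : MvPolynomial (Fin n) ℂ) ^ a i = monomial (expo a) 1 := by
  rw [monomial_eq, C_1, one_mul, Finsupp.prod_fintype _ _ (by simp)]
  rfl

theorem coeff_rename_expo (σ : Equiv.Perm (Fin n)) (H : MvPolynomial (Fin n) ℂ) (a : Fin n → ℕ) :
    coeff (expo a) (rename σ H) = coeff (expo (a ∘ σ)) H := by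
  have h : Finsupp.mapDomain σ (expo (a ∘ σ)) = expo a := by
    ext i
    rw [Finsupp.mapDomain_equiv_apply]
    simp
  rw [← coeff_rename_mapDomain σ σ.injective H, h]

theorem exists_antitone_comp (a : Fin n → ℕ) : ∃ σ : Equiv.Perm (Fin n), Antitone (a ∘ σ) := by
  refine ⟨Fin.revPerm.trans (Tuple.sort a), ?_⟩
  have := Tuple.monotone_sort a
  intro i j hij
  exact this (Fin.rev_le_rev.2 hij)

theorem eq_of_antitone_comp {a b : Fin n → ℕ} (ha : Antitone a) (hb : Antitone b)
    (σ : Equiv.Perm (Fin n)) (h : a ∘ σ = b) : a = b := by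
  subst h
  have := Tuple.unique_monotone (f := a) (σ := Fin.revPerm) (τ := Fin.revPerm.trans σ)
    (fun i j hij => ha (Fin.rev_le_rev.2 hij)) (fun i j hij => hb (Fin.rev_le_rev.2 hij))
  funext i
  have h2 := congrFun this (Fin.rev i)
  simpa using h2

/-! #### Schur polynomials as generating functions of tableaux -/

theorem mem_diagram (lam : PartitionSeq n) (i j : ℕ) :
    (i, j) ∈ lam.diagram ↔ j < rowLength lam.1 i := by
  rw [PartitionSeq.diagram, YoungDiagram.mem_ofRowLens]
  simp only [List.length_ofFn, List.getElem_ofFn, rowLength]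
  by_cases h : i < n
  · simp [h]
  · simp [h]

theorem prod_cells {R : Type*} [CommMonoid R] (lam : PartitionSeq n) (f : ℕ → ℕ → R) :
    ∏ c ∈ lam.diagram.cells, f c.1 c.2 = ∏ i : Fin n, ∏ j ∈ range (lam.1 i), f i j := by
  rw [prod_sigma']
  symm
  refine prod_bij (fun p _ => ((p.1 : ℕ), p.2)) ?_ ?_ ?_ ?_
  · rintro ⟨i, j⟩ h
    simp only [mem_sigma, mem_univ, mem_range, true_and] at h
    rw [YoungDiagram.mem_cells, mem_diagram, rowLength_coe]
    exact h
  · rintro ⟨i, j⟩ - ⟨i', j'⟩ - h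
    simp only [Prod.mk.injEq] at h
    obtain ⟨h1, rfl⟩ := h
    obtain rfl := Fin.ext h1
    rfl
  · rintro ⟨i, j⟩ h
    rw [YoungDiagram.mem_cells, mem_diagram] at h
    by_cases hi : i < n
    · refine ⟨⟨⟨i, hi⟩, j⟩, ?_, rfl⟩
      rw [rowLength, dif_pos hi] at h
      simpa using h
    · rw [rowLength_of_le _ (by omega)] at h
      omega
  · rintro ⟨i, j⟩ _
    rfl

/-- The content of a tableau: the number of entries equal to `i`, for each `i`. -/
def content (lam : PartitionSeq n) (T : ℕ → ℕ → ℕ) (i : Fin n) : ℕ :=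
  #{c ∈ lam.diagram.cells | T c.1 c.2 = i}

theorem tableauWeight_eq (lam : PartitionSeq n) {T : ℕ → ℕ → ℕ} (hT : IsTableau lam.1 T) :
    tableauWeight (xvar n) lam.1 T = monomial (expo (content lam T)) 1 := by
  rw [← prod_X_pow_eq_monomial_expo, tableauWeight, ← prod_cells lam fun i j => xvar n (T i j)]
  rw [← prod_fiberwise_of_maps_to (s := lam.diagram.cells) (t := range n)
    (g := fun c => T c.1 c.2) fun c hc => mem_range.2 (hT.lt _ _ ((mem_diagram lam _ _).1 hc)),
    ← Fin.prod_univ_eq_prod_range (fun m => ∏ c ∈ lam.diagram.cells with T c.1 c.2 = m,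
      xvar n (T c.1 c.2)) n]
  refine prod_congr rfl fun i _ => ?_
  rw [prod_congr rfl (g := fun _ => X i), prod_const]
  · rfl
  · intro c hc
    rw [(mem_filter.1 hc).2, xvar_coe]

theorem sum_content (lam : PartitionSeq n) {T : ℕ → ℕ → ℕ} (hT : IsTableau lam.1 T) :
    ∑ i, content lam T i = ∑ i, lam.1 i := by
  have h1 : #lam.diagram.cells = ∑ i, lam.1 i := by
    have := prod_cells (R := Multiplicative ℕ) lam fun _ _ => Multiplicative.ofAdd 1
    have h2 := congrArg Multiplicative.toAdd this
    simpa using h2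
  rw [← h1, card_eq_sum_card_fiberwise (t := range n) (f := fun c => T c.1 c.2) fun c hc =>
    mem_coe.2 (mem_range.2 (hT.lt _ _ ((mem_diagram lam _ _).1 hc))),
    ← Fin.sum_univ_eq_sum_range (fun m => #{c ∈ lam.diagram.cells | T c.1 c.2 = m}) n]
  rfl

/-- The generating function of the tableaux of shape `lam`. -/
noncomputable def tableauSum (lam : PartitionSeq n) : MvPolynomial (Fin n) ℂ :=
  ∑ T ∈ tableaux lam.1, tableauWeight (xvar n) lam.1 T

theorem coeff_tableauSum (lam : PartitionSeq n) (a : Fin n → ℕ) :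
    coeff (expo a) (tableauSum lam) = #{T ∈ tableaux lam.1 | content lam T = a} := by
  rw [tableauSum, coeff_sum, card_filter, Nat.cast_sum]
  refine sum_congr rfl fun T hT => ?_
  rw [tableauWeight_eq lam ((mem_tableaux lam.2).1 hT), coeff_monomial]
  simp [expo_inj]

theorem kostka_eq (lam mu : PartitionSeq n) :
    kostka lam mu = #{T ∈ tableaux lam.1 | content lam T = mu.1} := by
  rw [← Set.ncard_coe_finset, kostka, ← Set.ncard_image_of_injective _ DFunLike.coe_injective]
  congr 1
  ext T
  simp only [Set.mem_image, coe_filter, Set.mem_ofPred_eq]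
  constructor
  · rintro ⟨T, ⟨h1, h2⟩, rfl⟩
    refine ⟨(mem_tableaux lam.2).2 ⟨?_, ?_, ?_, ?_⟩, funext h2⟩
    · exact fun i j₁ j₂ h h' => T.row_weak h ((mem_diagram lam _ _).2 h')
    · exact fun i₁ i₂ j h h' => T.col_strict h ((mem_diagram lam _ _).2 h')
    · exact fun i j h => T.zeros fun h' => absurd ((mem_diagram lam _ _).1 h') (not_lt.2 h)
    · exact fun i j h => h1 (i, j) ((mem_diagram lam _ _).2 h)
  · rintro ⟨h1, h2⟩
    have h1 := (mem_tableaux lam.2).1 h1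
    refine ⟨⟨T, fun h h' => h1.row_weak _ _ _ h ((mem_diagram lam _ _).1 h'),
      fun h h' => h1.col_strict _ _ _ h ((mem_diagram lam _ _).1 h'),
      fun h => h1.zeros _ _ (not_lt.1 fun h' => h ((mem_diagram lam _ _).2 h'))⟩, ⟨?_, ?_⟩, rfl⟩
    · exact fun c hc => h1.lt _ _ ((mem_diagram lam _ _).1 hc)
    · exact fun i => congrFun h2 i

/-! #### Antisymmetric polynomials -/

/-- A polynomial which changes by the sign under permutations of the variables. -/
def IsAlternatingPoly (H : MvPolynomial (Fin n) ℂ) : Prop :=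
  ∀ σ : Equiv.Perm (Fin n), rename σ H = ((Equiv.Perm.sign σ : ℤ) : MvPolynomial (Fin n) ℂ) * H

theorem isAlternatingPoly_alternant (lam : Fin n → ℕ) :
    IsAlternatingPoly (alternant (xvar n) lam) := by
  intro σ
  rw [alternant, AlgHom.map_det, ← Matrix.det_permute]
  congr 1
  ext1 i j
  simp

/-- An alternating polynomial is determined by its coefficients at strictly decreasing exponents:
the coefficients at exponents with a repetition vanish. -/
theorem IsAlternatingPoly.eq_zero {H : MvPolynomial (Fin n) ℂ} (hH : IsAlternatingPoly H)
    (h : ∀ a, StrictAnti a → coeff (expo a) H = 0) : H = 0 := by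
  have hc : ∀ (σ : Equiv.Perm (Fin n)) (a : Fin n → ℕ),
      coeff (expo (a ∘ σ)) H = ((Equiv.Perm.sign σ : ℤ) : ℂ) * coeff (expo a) H := by
    intro σ a
    rw [← coeff_rename_expo, hH σ, ← map_intCast (C : ℂ →+* MvPolynomial (Fin n) ℂ), coeff_C_mul]
  ext e
  rw [← expo_coe e, coeff_zero]
  by_cases he : Function.Injective e
  · obtain ⟨σ, hσ⟩ := exists_antitone_comp e
    have h1 := h _ (hσ.strictAnti_of_injective (he.comp σ.injective))
    rw [hc] at h1
    rcases Int.units_eq_one_or (Equiv.Perm.sign σ) with h2 | h2 <;> simpa [h2] using h1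
  · simp only [Function.Injective] at he
    push Not at he
    obtain ⟨i, j, hij, hne⟩ := he
    have h1 := hc (Equiv.swap i j) e
    have h2 : (e : Fin n → ℕ) ∘ Equiv.swap i j = e := by
      funext k
      rcases eq_or_ne k i with rfl | hki
      · simp [hij]
      · rcases eq_or_ne k j with rfl | hkj
        · simp [hij]
        · simp [Equiv.swap_apply_of_ne_of_ne hki hkj]
    rw [h2, Equiv.Perm.sign_swap hne] at h1
    have h3 : coeff (expo e) H = - coeff (expo e) H := by simpa using h1
    exact self_eq_neg.1 h3

/-- The exponents of the leading monomial of an alternant. -/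
def shifted (lam : Fin n → ℕ) (i : Fin n) : ℕ := lam i + (n - 1 - i)

theorem shifted_strictAnti {lam : Fin n → ℕ} (h : Antitone lam) : StrictAnti (shifted lam) := by
  intro i j hij
  have h1 := h hij.le
  have h2 : (i : ℕ) < j := hij
  simp only [shifted]
  omega

theorem exists_shifted_eq {a : Fin n → ℕ} (ha : StrictAnti a) :
    ∃ lam : PartitionSeq n, shifted lam.1 = a := by
  have key : ∀ i j : Fin n, i ≤ j → a j + (j - i) ≤ a i := by
    have : ∀ (k : ℕ) (i j : Fin n), (j : ℕ) = i + k → a j + k ≤ a i := by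
      intro k
      induction k with
      | zero => intro i j h; obtain rfl : j = i := Fin.ext h; simp
      | succ k ih =>
        intro i j h
        have h1 := ih i ⟨i + k, by omega⟩ rfl
        have h2 := ha (show (⟨i + k, by omega⟩ : Fin n) < j from by rw [Fin.lt_def, h]; simp)
        omega
    intro i j hij
    exact this _ i j (by have : (i : ℕ) ≤ j := hij; omega)
  have hn : ∀ i : Fin n, n - 1 - i ≤ a i := by
    intro i
    have hi := i.2
    have := key i ⟨n - 1, by omega⟩ (show (i : ℕ) ≤ n - 1 by omega)
    simp only at this
    omega
  refine ⟨⟨fun i => a i - (n - 1 - i), fun i j hij => ?_⟩, ?_⟩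
  · have h1 := key i j hij
    have h2 := hn j
    have : (i : ℕ) ≤ j := hij
    simp only
    omega
  · funext i
    have := hn i
    simp only [shifted]
    omega

theorem coeff_alternant (lam mu : PartitionSeq n) :
    coeff (expo (shifted mu.1)) (alternant (xvar n) lam.1) = if lam = mu then 1 else 0 := by
  have hl := shifted_strictAnti lam.2
  have hm := shifted_strictAnti mu.2
  rw [alternant, Matrix.det_apply', coeff_sum]
  have key : ∀ σ : Equiv.Perm (Fin n), coeff (expo (shifted mu.1))
      (((Equiv.Perm.sign σ : ℤ) : MvPolynomial (Fin n) ℂ) * ∏ i, (Matrix.of fun i j : Fin n =>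
        xvar n i ^ (lam.1 j + (n - 1 - j))) (σ i) i) =
      if shifted lam.1 ∘ ⇑σ⁻¹ = shifted mu.1 then ((Equiv.Perm.sign σ : ℤ) : ℂ) else 0 := by
    intro σ
    rw [← map_intCast (C : ℂ →+* MvPolynomial (Fin n) ℂ), coeff_C_mul,
      ← Equiv.prod_comp σ⁻¹]
    have : ∀ i, (Matrix.of fun i j : Fin n => xvar n i ^ (lam.1 j + (n - 1 - j)))
      (σ (σ⁻¹ i)) (σ⁻¹ i) = X i ^ (shifted lam.1 ∘ ⇑σ⁻¹) i := by
      intro i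
      simp [shifted]
    simp only [this]
    rw [prod_X_pow_eq_monomial_expo, coeff_monomial]
    simp [expo_inj]
  simp only [key]
  by_cases h : lam = mu
  · subst h
    rw [if_pos rfl, sum_eq_single 1]
    · simp
    · intro σ _ hσ
      rw [if_neg]
      intro h
      refine hσ ?_
      ext1 i
      have h1 := congrFun h (σ i)
      rw [Function.comp_apply, show σ⁻¹ (σ i) = i from σ.symm_apply_apply i] at h1
      exact (hl.injective h1).symm
    · simp
  · rw [if_neg h]
    refine sum_eq_zero fun σ _ => if_neg fun h1 => h ?_
    have h2 := eq_of_antitone_comp hl.antitone hm.antitone _ h1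
    ext i
    have := congrFun h2 i
    simpa [shifted] using this

theorem vprod_eq : vprod n (xvar n) = alternant (xvar n) (fun _ : Fin n => 0) := by
  rw [alternant_eq _ antitone_const]
  have h : tableaux (fun _ : Fin n => 0) = {fun _ _ => 0} := by
    ext T
    rw [mem_tableaux antitone_const, mem_singleton]
    have h0 : ∀ i, rowLength (fun _ : Fin n => 0) i = 0 := by intro i; simp [rowLength]
    constructor
    · intro hT
      funext i j
      exact hT.zeros i j (by simp [h0])
    · rintro rfl
      exact ⟨by simp, by simp [h0], by simp, by simp [h0]⟩
  rw [h, sum_singleton]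
  simp [tableauWeight]

theorem vprod_ne_zero : vprod n (xvar n) ≠ 0 := by
  intro h
  have := coeff_alternant (n := n) ⟨fun _ => 0, antitone_const⟩ ⟨fun _ => 0, antitone_const⟩
  rw [← vprod_eq, h] at this
  simp at this

/-- The quotient of an alternating polynomial by the Vandermonde product is symmetric. -/
theorem isSymmetric_of_vprod_mul {H : MvPolynomial (Fin n) ℂ}
    (h : IsAlternatingPoly (vprod n (xvar n) * H)) : H.IsSymmetric := by
  intro σ
  have h1 := h σ
  have h2 : IsAlternatingPoly (vprod n (xvar n)) := vprod_eq ▸ isAlternatingPoly_alternant _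
  rw [map_mul, h2 σ, mul_assoc] at h1
  rcases Int.units_eq_one_or (Equiv.Perm.sign σ) with h3 | h3
  · rw [h3] at h1
    simpa [vprod_ne_zero] using h1
  · rw [h3] at h1
    simpa [vprod_ne_zero] using h1

theorem tableauSum_isSymmetric (lam : PartitionSeq n) : (tableauSum lam).IsSymmetric :=
  isSymmetric_of_vprod_mul (by
    rw [tableauSum, ← alternant_eq _ lam.2]
    exact isAlternatingPoly_alternant _)

theorem coeff_monomialSym (mu : PartitionSeq n) (a : Fin n → ℕ) :
    coeff (expo a) (monomialSym mu) = if ∃ σ : Equiv.Perm (Fin n), mu.1 ∘ σ = a then 1 else 0 := by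
  rw [monomialSym, coeff_sum]
  simp only [prod_X_pow_eq_monomial_expo, coeff_monomial, expo_inj, sum_ite_eq', mem_image,
    mem_univ, true_and]

/-- The definition by Kostka numbers agrees with the generating function, since the latter is
symmetric. -/
theorem schur_eq (lam : PartitionSeq n) : schur lam = tableauSum lam := by
  ext e
  rw [← expo_coe e]
  obtain ⟨σ, hσ⟩ := exists_antitone_comp e
  let mu : PartitionSeq n := ⟨e ∘ σ, hσ⟩
  have h1 : coeff (expo e) (tableauSum lam) = coeff (expo mu.1) (tableauSum lam) := by
    rw [← coeff_rename_expo, tableauSum_isSymmetric lam σ]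
  have h2 : ∀ nu : PartitionSeq n, (∃ τ : Equiv.Perm (Fin n), nu.1 ∘ τ = e) ↔ nu = mu := by
    intro nu
    constructor
    · rintro ⟨τ, hτ⟩
      refine Subtype.ext (eq_of_antitone_comp nu.2 mu.2 (σ.trans τ) ?_)
      change _ = e ∘ σ
      rw [← hτ]
      rfl
    · rintro rfl
      refine ⟨σ⁻¹, ?_⟩
      funext i
      simp [mu]
  rw [h1, coeff_tableauSum, schur, coeff_sum]
  simp only [coeff_smul, coeff_monomialSym, h2, smul_eq_mul, mul_ite, mul_one, mul_zero]
  rw [sum_ite_eq', kostka_eq]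
  split_ifs with h
  · rfl
  · symm
    rw [Nat.cast_eq_zero, card_eq_zero, filter_eq_empty_iff]
    intro T hT hc
    refine h ?_
    have := sum_content lam ((mem_tableaux lam.2).1 hT)
    rw [hc] at this
    simp only [partitionsOf, mem_subtype, mem_piAntidiag]
    simp [this]

theorem vprod_mul_schur (lam : PartitionSeq n) :
    vprod n (xvar n) * schur lam = alternant (xvar n) lam.1 := by
  rw [schur_eq, tableauSum, alternant_eq _ lam.2]

/-- The coefficients of the expansion of a symmetric polynomial into Schur polynomials are
coefficients of its product with the Vandermonde product. -/
theorem eq_sum_schur_iff {G : MvPolynomial (Fin n) ℂ} (hG : G.IsSymmetric)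
    (d : PartitionSeq n →₀ ℂ) : (G = d.sum fun lam a => a • schur lam) ↔
      ∀ lam : PartitionSeq n, d lam = coeff (expo (shifted lam.1)) (vprod n (xvar n) * G) := by
  have hsum : vprod n (xvar n) * (d.sum fun lam a => a • schur lam) =
      d.sum fun lam a => a • alternant (xvar n) lam.1 := by
    simp only [Finsupp.sum, mul_sum, mul_smul_comm, vprod_mul_schur]
  have hcoeff : ∀ lam : PartitionSeq n, coeff (expo (shifted lam.1))
      (d.sum fun lam a => a • alternant (xvar n) lam.1) = d lam := by
    intro lam
    simp only [Finsupp.sum, coeff_sum, coeff_smul, coeff_alternant, smul_eq_mul, mul_ite, mul_one,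
      mul_zero]
    rw [sum_ite_eq']
    split_ifs with h
    · rfl
    · exact (Finsupp.notMem_support_iff.1 h).symm
  constructor
  · intro h lam
    rw [h, hsum, hcoeff]
  · intro h
    refine mul_left_cancel₀ (vprod_ne_zero (n := n)) ?_
    rw [hsum, ← sub_eq_zero]
    refine IsAlternatingPoly.eq_zero ?_ ?_
    · intro σ
      have h2 : IsAlternatingPoly (vprod n (xvar n)) := vprod_eq ▸ isAlternatingPoly_alternant _
      rw [map_sub, map_mul, hG σ, h2 σ, mul_sub, mul_assoc]
      congr 1
      simp only [Finsupp.sum, map_sum, map_smul, mul_sum]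
      refine sum_congr rfl fun lam _ => ?_
      rw [isAlternatingPoly_alternant lam.1 σ, mul_smul_comm]
    · intro a ha
      obtain ⟨lam, rfl⟩ := exists_shifted_eq ha
      rw [coeff_sub, hcoeff, h, sub_self]

end SchurExpansion

/-! ### Multiplication by differences of variables -/

section Raising

open MvPolynomial

variable {n : ℕ}

/-- The exponent vector with the entries of a list, which is continued by zeros. -/
noncomputable def listExpo (n : ℕ) (l : List ℕ) : Fin n →₀ ℕ := expo fun i => l.getD i 0

theorem listExpo_append_replicate (l : List ℕ) (k : ℕ) :
    listExpo n (l ++ List.replicate k 0) = listExpo n l := by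
  refine expo_inj.2 (funext fun i => ?_)
  rcases lt_or_ge (i : ℕ) l.length with h | h
  · rw [List.getD_append _ _ _ _ h]
  · rw [List.getD_append_right _ _ _ _ h, List.getD_eq_default _ _ h]
    rcases lt_or_ge (i - l.length : ℕ) k with h | h
    · rw [List.getD_replicate _ h]
    · rw [List.getD_eq_default _ _ (by simpa using h)]

theorem listExpo_ofFn (a : Fin n → ℕ) : listExpo n (List.ofFn a) = expo a := by
  refine expo_inj.2 (funext fun i => ?_)
  rw [List.getD_eq_getElem _ _ (by simp)]
  simp

theorem coeff_mul_xvar_succ (P : MvPolynomial (Fin n) ℂ) (A : List ℕ) (c : ℕ) (B : List ℕ)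
    (hA : A.length < n) : coeff (listExpo n (A ++ (c + 1) :: B)) (P * xvar n A.length) =
      coeff (listExpo n (A ++ c :: B)) P := by
  have h : listExpo n (A ++ (c + 1) :: B) =
      listExpo n (A ++ c :: B) + Finsupp.single ⟨A.length, hA⟩ 1 := by
    ext i
    simp only [listExpo, expo_apply, Finsupp.add_apply, Finsupp.single_apply, Fin.ext_iff]
    rcases lt_trichotomy (i : ℕ) A.length with h | h | h
    · rw [List.getD_append _ _ _ _ h, List.getD_append _ _ _ _ h, if_neg (by omega), add_zero]
    · rw [List.getD_append_right _ _ _ _ h.ge, List.getD_append_right _ _ _ _ h.ge,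
        if_pos h.symm, h]
      simp
    · rw [List.getD_append_right _ _ _ _ h.le, List.getD_append_right _ _ _ _ h.le,
        if_neg (by omega), add_zero]
      obtain ⟨k, hk⟩ : ∃ k, (i : ℕ) - A.length = k + 1 := ⟨i - A.length - 1, by omega⟩
      rw [hk, List.getD_cons_succ, List.getD_cons_succ]
  rw [h, show xvar n A.length = X ⟨A.length, hA⟩ from dif_pos hA, coeff_mul_X]

theorem coeff_mul_xvar_zero (P : MvPolynomial (Fin n) ℂ) (A B : List ℕ) :
    coeff (listExpo n (A ++ 0 :: B)) (P * xvar n A.length) = 0 := by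
  rw [xvar]
  split_ifs with hA
  · rw [coeff_mul_X', if_neg]
    simp [listExpo]
  · rw [mul_zero, coeff_zero]

/-- The sign of a parity. -/
def paritySign (s : Bool) : ℤ := if s then -1 else 1

theorem paritySign_not (s : Bool) : paritySign (!s) = -paritySign s := by
  cases s <;> simp [paritySign]

/-- The leaves of `raiseTree` correspond to the terms in the expansion of a product of
differences `x_i - x_j`, where `i` is fixed. -/
theorem coeff_mul_prod_sub (P : MvPolynomial (Fin n) ℂ) (A D B : List ℕ) (c : ℕ) (s : Bool)
    (hn : A.length + 1 + D.length + B.length = n) :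
    paritySign s * coeff (listExpo n (A ++ (c + B.length) :: (D ++ B)))
      (P * ∏ j ∈ Finset.Ico (A.length + 1 + D.length) n, (xvar n A.length - xvar n j)) =
      ((raiseTree B c s).leaves.map fun x => (paritySign x.2.2 : ℂ) *
        coeff (listExpo n (A ++ x.2.1 :: (D ++ x.1))) P).sum := by
  induction B generalizing c s D with
  | nil =>
    rw [List.length_nil, add_zero] at hn
    simp [raiseTree, BitTree.leaves, hn]
  | cons b B ih =>
    rw [List.length_cons] at hn
    have hD : A.length + 1 + D.length + 1 = A.length + 1 + (D ++ [b]).length := by simp; omega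
    have hlt : A.length + 1 + D.length < n := by omega
    have hstep : ∀ e : ℕ, e :: (D ++ b :: B) = e :: ((D ++ [b]) ++ B) := by simp
    set Q := P * ∏ j ∈ Finset.Ico (A.length + 1 + D.length + 1) n,
      (xvar n A.length - xvar n j) with hQ
    have hprod : P * ∏ j ∈ Finset.Ico (A.length + 1 + D.length) n,
        (xvar n A.length - xvar n j) =
        Q * xvar n A.length - Q * xvar n (A.length + 1 + D.length) := by
      rw [Finset.prod_eq_prod_Ico_succ_bot hlt, hQ]
      ring
    have hlen : ∀ e : ℕ, (A ++ e :: D).length = A.length + 1 + D.length := by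
      intro e; simp; omega
    have hsplit : ∀ (e b' : ℕ) (B' : List ℕ),
        A ++ e :: (D ++ b' :: B') = (A ++ e :: D) ++ b' :: B' := by simp
    have hleft : paritySign s * coeff (listExpo n (A ++ (c + B.length) :: (D ++ b :: B))) Q =
        ((raiseTree B c s).leaves.map fun x => (paritySign x.2.2 : ℂ) *
          coeff (listExpo n (A ++ x.2.1 :: (D ++ b :: x.1))) P).sum := by
      have := ih (D ++ [b]) c s (by simp; omega)
      rw [← hD] at this
      simpa [hQ] using this
    have hcount : c + (b :: B).length = (c + B.length) + 1 := by simp; omega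
    rw [hprod, coeff_sub, mul_sub, hcount, coeff_mul_xvar_succ _ _ _ _ (by omega), hleft, hsplit,
      ← hlen (c + B.length + 1)]
    rcases b with _ | b
    · rw [coeff_mul_xvar_zero]
      simp [raiseTree, BitTree.leaves, BitTree.leaves_map, Function.comp_def]
    · have hright : paritySign (!s) *
          coeff (listExpo n (A ++ (c + 1 + B.length) :: (D ++ b :: B))) Q =
          ((raiseTree B (c + 1) (!s)).leaves.map fun x => (paritySign x.2.2 : ℂ) *
            coeff (listExpo n (A ++ x.2.1 :: (D ++ b :: x.1))) P).sum := by
        have := ih (D ++ [b]) (c + 1) (!s) (by simp; omega)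
        rw [show A.length + 1 + (D ++ [b]).length = A.length + 1 + D.length + 1 by
          simp; omega] at this
        simpa [hQ] using this
      rw [coeff_mul_xvar_succ _ _ _ _ (by rw [hlen]; exact hlt), ← hsplit,
        show c + B.length + 1 = c + 1 + B.length by omega, sub_eq_add_neg, ← neg_mul]
      have hneg : -(paritySign s : ℂ) = (paritySign (!s) : ℤ) := by
        rw [paritySign_not]; push_cast; rfl
      rw [hneg, hright]
      simp [raiseTree, BitTree.leaves, BitTree.leaves_map, Function.comp_def]

theorem length_of_mem_raiseTree {B : List ℕ} {c : ℕ} {s : Bool} {x}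
    (h : x ∈ (raiseTree B c s).leaves) : x.1.length = B.length := by
  induction B generalizing c s x with
  | nil => simp [raiseTree, BitTree.leaves] at h; simp [h]
  | cons b B ih =>
    rcases b with _ | b
    · simp only [raiseTree, BitTree.leaves, BitTree.leaves_map, List.append_nil, List.mem_map] at h
      obtain ⟨x, hx, rfl⟩ := h
      simp [ih hx]
    · simp only [raiseTree, BitTree.leaves, BitTree.leaves_map, List.mem_append, List.mem_map] at h
      obtain ⟨x, hx, rfl⟩ | ⟨x, hx, rfl⟩ := h <;> simp [ih hx]

theorem length_of_mem_rowsTree {R B : List ℕ} {s : Bool} {x} (h : x ∈ (rowsTree R B s).leaves) :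
    x.1.length = R.length + B.length := by
  induction R generalizing B s with
  | nil => simp [rowsTree, BitTree.leaves] at h; simp [h]
  | cons r R ih =>
    simp only [rowsTree, BitTree.leaves_bind, List.mem_flatMap] at h
    obtain ⟨z, hz, h⟩ := h
    rw [ih h, List.length_cons, List.length_cons, length_of_mem_raiseTree hz]
    omega

/-- The leaves of `rowsTree` correspond to the terms in the expansion of a product of
differences `x_i - x_j`, where `i` runs over the rows in the first list. -/
theorem coeff_prod_mul (G : MvPolynomial (Fin n) ℂ) (R B : List ℕ) (s : Bool)
    (hn : R.length + B.length = n) :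
    paritySign s * coeff (listExpo n ((R.reverse.mapIdx fun i r => r + (n - 1 - i)) ++ B))
      (G * ∏ i ∈ Finset.range R.length, ∏ j ∈ Finset.Ico (i + 1) n, (xvar n i - xvar n j)) =
      ((rowsTree R B s).leaves.map fun x =>
        (paritySign x.2 : ℂ) * coeff (listExpo n x.1) G).sum := by
  induction R generalizing B s with
  | nil => simp [rowsTree, BitTree.leaves]
  | cons r R ih =>
    rw [List.length_cons] at hn
    set A := R.reverse.mapIdx fun i r => r + (n - 1 - i) with hA
    have hlen : A.length = R.length := by simp [hA]
    have h1 := coeff_mul_prod_sub (G * ∏ i ∈ Finset.range R.length,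
      ∏ j ∈ Finset.Ico (i + 1) n, (xvar n i - xvar n j)) A [] B r s (by simp; omega)
    have h2 : ((r :: R).reverse.mapIdx fun i r => r + (n - 1 - i)) ++ B =
        A ++ (r + B.length) :: ([] ++ B) := by
      rw [List.reverse_cons, List.mapIdx_append]
      simp [← hA]
      omega
    rw [h2, List.length_cons, Finset.prod_range_succ, ← mul_assoc]
    rw [hlen] at h1
    simp only [List.length_nil, add_zero] at h1
    rw [h1, rowsTree, BitTree.leaves_bind, List.map_flatMap, List.flatMap_def,
      List.sum_flatten, List.map_map]
    refine congrArg List.sum (List.map_congr_left fun x hx => ?_)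
    rw [Function.comp_apply, ← ih _ _ (by rw [List.length_cons, length_of_mem_raiseTree hx]; omega)]
    simp

theorem raiseTree_append_replicate_leaves (B : List ℕ) (k c : ℕ) (s : Bool) :
    (raiseTree (B ++ List.replicate k 0) c s).leaves =
      (raiseTree B c s).leaves.map fun x => (x.1 ++ List.replicate k 0, x.2) := by
  induction B generalizing c s with
  | nil =>
    induction k with
    | zero => simp [raiseTree, BitTree.leaves]
    | succ k ih =>
      rw [List.nil_append] at ih
      simp [List.replicate_succ, raiseTree, BitTree.leaves, BitTree.leaves_map, ih]
  | cons b B ih =>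
    rcases b with _ | b <;>
      simp [raiseTree, BitTree.leaves, BitTree.leaves_map, ih, Function.comp_def]

theorem rowsTree_append_replicate_leaves (R B : List ℕ) (k : ℕ) (s : Bool) :
    (rowsTree R (B ++ List.replicate k 0) s).leaves =
      (rowsTree R B s).leaves.map fun x => (x.1 ++ List.replicate k 0, x.2) := by
  induction R generalizing B s with
  | nil => simp [rowsTree, BitTree.leaves]
  | cons r R ih =>
    simp only [rowsTree, BitTree.leaves_bind, raiseTree_append_replicate_leaves, List.flatMap_map,
      List.map_flatMap, ← List.cons_append, ih]

/-- Empty rows at the end of the partition receive no units and give none. -/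
theorem rowsTree_replicate_append_leaves (R : List ℕ) (k m : ℕ) (s : Bool) :
    (rowsTree (List.replicate k 0 ++ R) (List.replicate m 0) s).leaves =
      (rowsTree R [] s).leaves.map fun x => (x.1 ++ List.replicate (k + m) 0, x.2) := by
  induction k generalizing m with
  | zero => simpa using rowsTree_append_replicate_leaves R [] m s
  | succ k ih =>
    have h := raiseTree_append_replicate_leaves [] m 0 s
    rw [List.nil_append] at h
    rw [List.replicate_succ, List.cons_append, rowsTree, BitTree.leaves_bind, h]
    simp only [raiseTree, BitTree.leaves, List.map_cons, List.map_nil, List.flatMap_cons,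
      List.flatMap_nil, List.append_nil, List.nil_append]
    rw [← List.replicate_succ, ih, show k + (m + 1) = k + 1 + m by omega]

theorem eq_filter_append_replicate {l : List ℕ} (h : l.SortedGE) :
    ∃ k, l = l.filter (fun a => a ≠ 0) ++ List.replicate k 0 := by
  replace h := h.pairwise
  induction l with
  | nil => exact ⟨0, rfl⟩
  | cons a l ih =>
    rw [List.pairwise_cons] at h
    rcases Nat.eq_zero_or_pos a with rfl | ha
    · have h0 : ∀ b ∈ l, b = 0 := fun b hb => Nat.le_zero.1 (h.1 b hb)
      refine ⟨l.length + 1, ?_⟩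
      have h1 : (0 :: l).filter (fun a => a ≠ 0) = [] := by
        rw [List.filter_eq_nil_iff]
        intro b hb
        rcases List.mem_cons.1 hb with rfl | hb
        · simp
        · simp [h0 b hb]
      rw [h1, List.nil_append, List.replicate_succ, ← List.eq_replicate_of_mem h0]
    · obtain ⟨k, hk⟩ := ih h.2
      refine ⟨k, ?_⟩
      rw [List.filter_cons_of_pos (by simpa using ha.ne'), List.cons_append, ← hk]

theorem vprod_eq_prod_Ico : vprod n (xvar n) =
    ∏ i ∈ Finset.range n, ∏ j ∈ Finset.Ico (i + 1) n, (xvar n i - xvar n j) := by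
  rw [vprod]
  refine Finset.prod_comm' fun i j => ?_
  simp only [Finset.mem_range, Finset.mem_Ico]
  omega

/-- The coefficients of the product with the Vandermonde product, as signed sums over the leaves
of `rowsTree`. They only depend on the nonzero parts of the partition. -/
theorem coeff_vprod_mul (G : MvPolynomial (Fin n) ℂ) (lam : PartitionSeq n) :
    coeff (expo (shifted lam.1)) (vprod n (xvar n) * G) =
      ((rowsTree ((List.ofFn lam.1).filter fun a => a ≠ 0).reverse [] false).leaves.map fun x =>
        (paritySign x.2 : ℂ) * coeff (listExpo n x.1) G).sum := by
  have h := coeff_prod_mul G (List.ofFn lam.1).reverse [] false (by simp)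
  have h1 : ((List.ofFn lam.1).mapIdx fun i r => r + (n - 1 - i)) =
      List.ofFn (shifted lam.1) := by
    apply List.ext_getElem
    · simp
    · intro i h1 h2
      simp [shifted]
  rw [List.reverse_reverse, List.append_nil, h1, listExpo_ofFn, List.length_reverse,
    List.length_ofFn, ← vprod_eq_prod_Ico, mul_comm G] at h
  simp only [paritySign, Bool.false_eq_true, if_false, Int.cast_one, one_mul] at h
  rw [h]
  obtain ⟨k, hk⟩ := eq_filter_append_replicate lam.2.sortedGE_ofFn
  generalize (List.ofFn lam.1).filter (fun a => a ≠ 0) = l at hk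
  have h2 := rowsTree_replicate_append_leaves l.reverse k 0 false
  rw [List.replicate_zero] at h2
  rw [hk, List.reverse_append, List.reverse_replicate, h2, List.map_map]
  refine congrArg List.sum (List.map_congr_left fun x _ => ?_)
  simp [listExpo_append_replicate, paritySign]

end Raising

/-! ### Coefficients of quasisymmetric polynomials -/

section QuasiSymmetric

open MvPolynomial

variable {n : ℕ}

/-- The leaves of `mergeTree` are the coarsenings of `p :: l`; here `t` consists of the parts merged
with `p`, and `L` of the other blocks. -/
theorem mem_leaves_mergeTree {p : ℕ} {l y : List ℕ} (hy : 0 ∉ y) :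
    y ∈ (mergeTree true p l).leaves ↔
      ∃ t : List ℕ, ∃ L : List (List ℕ), t ++ L.flatten = l ∧
        (p + t.sum) :: L.map List.sum = y := by
  induction l generalizing p y with
  | nil =>
    simp only [mergeTree, BitTree.leaves, List.mem_singleton, List.append_eq_nil_iff]
    constructor
    · rintro rfl
      exact ⟨[], [], by simp⟩
    · rintro ⟨t, L, ⟨rfl, hL⟩, rfl⟩
      rcases L with _ | ⟨a, L⟩
      · simp
      · rw [List.flatten_cons, List.append_eq_nil_iff] at hL
        simp [hL.1] at hy
  | cons q l ih =>
    simp only [mergeTree, if_true, BitTree.leaves, BitTree.leaves_map, List.mem_append,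
      List.mem_map]
    constructor
    · rintro (⟨y, h, rfl⟩ | h)
      · obtain ⟨t, L, rfl, rfl⟩ := (ih (fun h' => hy (List.mem_cons_of_mem _ h'))).1 h
        exact ⟨[], (q :: t) :: L, by simp⟩
      · obtain ⟨t, L, rfl, rfl⟩ := (ih hy).1 h
        exact ⟨q :: t, L, by simp [add_assoc]⟩
    · rintro ⟨t, L, h, rfl⟩
      rcases t with _ | ⟨q', t⟩
      · left
        rcases L with _ | ⟨_ | ⟨q', t⟩, L⟩
        · simp at h
        · simp at hy
        · simp only [List.nil_append, List.flatten_cons, List.cons_append, List.cons.injEq] at h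
          obtain ⟨rfl, rfl⟩ := h
          refine ⟨_, (ih fun h' => hy (List.mem_cons_of_mem _ h')).2 ⟨t, L, rfl, ?_⟩, ?_⟩ <;> simp
      · right
        simp only [List.cons_append, List.cons.injEq] at h
        obtain ⟨rfl, rfl⟩ := h
        exact (ih hy).2 ⟨t, L, rfl, by simp [add_assoc]⟩

theorem forall_mem_mergeTree {mg : Bool} {p : ℕ} {l y : List ℕ} (hl : 0 ∉ l) (hp : p ≠ 0)
    (h : y ∈ (mergeTree mg p l).leaves) :
    0 ∉ y ∧ y.length ≤ l.length + 1 ∧ ∃ a y', y = a :: y' ∧ p ≤ a := by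
  induction l generalizing p y with
  | nil =>
    simp only [mergeTree, BitTree.leaves, List.mem_singleton] at h
    subst h
    simp [hp.symm]
  | cons q l ih =>
    simp only [List.mem_cons, not_or] at hl
    have key : y ∈ ((mergeTree mg q l).map (p :: ·)).leaves → 0 ∉ y ∧
        y.length ≤ (q :: l).length + 1 ∧ ∃ a y', y = a :: y' ∧ p ≤ a := by
      rw [BitTree.leaves_map, List.mem_map]
      rintro ⟨y, hy, rfl⟩
      obtain ⟨h1, h2, -⟩ := ih hl.2 (Ne.symm hl.1) hy
      simpa [hp.symm, h1] using h2
    rw [mergeTree] at h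
    split_ifs at h
    · simp only [BitTree.leaves, List.mem_append] at h
      rcases h with h | h
      · exact key h
      · obtain ⟨h1, h2, a, y', h3, h4⟩ := ih hl.2 (by omega) h
        exact ⟨h1, by simp; omega, a, y', h3, by omega⟩
    · exact key h

theorem nodup_leaves_mergeTree {p : ℕ} {l : List ℕ} (hl : 0 ∉ l) (hp : p ≠ 0) :
    (mergeTree true p l).leaves.Nodup := by
  induction l generalizing p with
  | nil => simp [mergeTree, BitTree.leaves]
  | cons q l ih =>
    simp only [List.mem_cons, not_or] at hl
    simp only [mergeTree, if_true, BitTree.leaves, BitTree.leaves_map]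
    refine List.Nodup.append ((ih hl.2 (Ne.symm hl.1)).map List.cons_injective)
      (ih hl.2 (by omega)) ?_
    intro y hy hy'
    obtain ⟨z, -, rfl⟩ := List.mem_map.1 hy
    obtain ⟨-, -, a, y', h3, h4⟩ := forall_mem_mergeTree hl.2 (by omega) hy'
    rw [List.cons.injEq] at h3
    omega

theorem zero_notMem_filter (B : List ℕ) : 0 ∉ B.filter fun a => a ≠ 0 := by simp

theorem forall_mem_finTree {mg : Bool} {B y : List ℕ} (h : y ∈ (finTree mg B).leaves) :
    0 ∉ y ∧ y.length ≤ B.length := by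
  have h0 := zero_notMem_filter B
  have hle := List.length_filter_le (fun a => decide (a ≠ 0)) B
  rw [finTree] at h
  split at h
  · simp only [BitTree.leaves, List.mem_singleton] at h
    simp [h]
  · next p l hl =>
    rw [hl] at h0 hle
    simp only [List.mem_cons, not_or] at h0
    obtain ⟨h1, h2, -⟩ := forall_mem_mergeTree h0.2 (Ne.symm h0.1) h
    exact ⟨h1, h2.trans hle⟩

theorem finTree_false_leaves (B : List ℕ) :
    (finTree false B).leaves = [B.filter fun a => a ≠ 0] := by
  have key : ∀ (l : List ℕ) (p : ℕ), (mergeTree false p l).leaves = [p :: l] := by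
    intro l
    induction l with
    | nil => intro p; rfl
    | cons q l ih => intro p; simp [mergeTree, BitTree.leaves_map, ih]
  rw [finTree]
  split
  · next h => rw [h]; rfl
  · next p l h => rw [h, key]

open Classical in
/-- Every coarsening is obtained from exactly one leaf. -/
theorem count_finTree_true {B y : List ℕ} (hy : 0 ∉ y) : (finTree true B).leaves.count y =
    if ∃ L : List (List ℕ), L.flatten = (B.filter fun a => a ≠ 0) ∧ L.map List.sum = y
    then 1 else 0 := by
  have h0 := zero_notMem_filter B
  rw [finTree]
  split
  · next hB =>
    rw [hB]
    simp only [BitTree.leaves, List.count_singleton, beq_iff_eq]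
    congr 1
    apply propext
    constructor
    · rintro rfl
      exact ⟨[], by simp⟩
    · rintro ⟨L, hL, rfl⟩
      rcases L with _ | ⟨a, L⟩
      · rfl
      · rw [List.flatten_cons, List.append_eq_nil_iff] at hL
        simp [hL.1] at hy
  · next p l hB =>
    rw [hB] at h0 ⊢
    simp only [List.mem_cons, not_or] at h0
    rw [(nodup_leaves_mergeTree h0.2 (Ne.symm h0.1)).count]
    refine if_congr ((mem_leaves_mergeTree hy).trans ?_) rfl rfl
    constructor
    · rintro ⟨t, L, rfl, rfl⟩
      exact ⟨(p :: t) :: L, by simp⟩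
    · rintro ⟨L, hL, rfl⟩
      rcases L with _ | ⟨_ | ⟨p', t⟩, L⟩
      · simp at hL
      · simp at hy
      · simp only [List.flatten_cons, List.cons_append, List.cons.injEq] at hL
        obtain ⟨rfl, rfl⟩ := hL
        exact ⟨t, L, by simp⟩

theorem coeff_monomialQSym_expo {k : ℕ} (α : Composition k) (a : Fin n → ℕ) :
    coeff (expo a) (monomialQSym n α) =
      if (List.ofFn a).filter (fun b => b ≠ 0) = α.blocks then 1 else 0 := by
  classical
  -- the positions of the nonzero exponents
  set L := (List.finRange n).filter fun x => a x ≠ 0 with hL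
  have hLs : L.Pairwise (· < ·) := List.Pairwise.filter _ (List.pairwise_lt_finRange n)
  have hmem : ∀ x, x ∈ L ↔ a x ≠ 0 := by simp [hL]
  have hmap : (List.ofFn a).filter (fun b => b ≠ 0) = L.map a := by
    rw [List.ofFn_eq_map, List.filter_map]
    rfl
  have hprod : ∀ i : Fin α.length → Fin n, ∏ j, (X (i j) : MvPolynomial (Fin n) ℂ) ^
      α.blocksFun j = monomial (∑ j, Finsupp.single (i j) (α.blocksFun j)) 1 := by
    intro i
    rw [monomial_sum_one]
    exact Finset.prod_congr rfl fun j _ => X_pow_eq_monomial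
  have hval : ∀ i : Fin α.length → Fin n, StrictMono i → ∀ j,
      (∑ j, Finsupp.single (i j) (α.blocksFun j)) (i j) = α.blocksFun j := by
    intro i hi j
    rw [Finsupp.finsetSum_apply, Finset.sum_eq_single j]
    · simp
    · intro j' _ hne
      exact Finsupp.single_eq_of_ne (fun h => hne (hi.injective h.symm))
    · simp
  -- the only term that can contribute
  have hterm : ∀ i : Fin α.length → Fin n, StrictMono i →
      ∑ j, Finsupp.single (i j) (α.blocksFun j) = expo a →
      List.ofFn i = L ∧ L.map a = α.blocks := by
    intro i hi h
    have h1 : ∀ j, a (i j) = α.blocksFun j := by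
      intro j
      rw [← hval i hi j, h, expo_apply]
    have h2 : List.ofFn i = L := by
      refine List.Perm.eq_of_pairwise (le := (· < ·))
        (fun x y _ _ h1 h2 => absurd h1 h2.asymm) ?_ hLs ?_
      · exact (List.pairwise_ofFn).2 fun _ _ h => hi h
      · refine (List.perm_ext_iff_of_nodup ?_ ?_).2 fun x => ?_
        · exact List.nodup_ofFn.2 hi.injective
        · exact (List.nodup_finRange n).filter _
        · rw [hmem, List.mem_ofFn]
          constructor
          · rintro ⟨j, rfl⟩
            rw [h1]
            exact Nat.one_le_iff_ne_zero.1 (α.one_le_blocksFun j)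
          · intro hx
            rw [← expo_apply a x, ← h, Finsupp.finsetSum_apply] at hx
            obtain ⟨j, _, hj⟩ := Finset.exists_ne_zero_of_sum_ne_zero hx
            refine ⟨j, ?_⟩
            by_contra hne
            exact hj (Finsupp.single_eq_of_ne (Ne.symm hne))
    refine ⟨h2, ?_⟩
    rw [← h2, List.map_ofFn, ← α.ofFn_blocksFun]
    exact congrArg List.ofFn (funext h1)
  rw [monomialQSym, coeff_sum, hmap]
  simp only [hprod, coeff_monomial]
  split_ifs with h
  · have hlen : L.length = α.length := by rw [← List.length_map (f := a), h]
    set i : Fin α.length → Fin n := fun j => L[j] with hi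
    have hiL : List.ofFn i = L := by
      apply List.ext_getElem
      · simp [hlen]
      · intro j h1 h2; simp [hi]
    have him : StrictMono i := by
      intro j j' hj
      exact List.pairwise_iff_getElem.1 hLs j j' _ _ hj
    have hai : ∀ j, a (i j) = α.blocksFun j := by
      intro j
      have : α.blocks = List.ofFn (a ∘ i) := by rw [← List.map_ofFn, hiL, h]
      rw [← α.ofFn_blocksFun] at this
      exact (congrFun (List.ofFn_injective this) j).symm
    rw [Finset.sum_eq_single i, if_pos]
    · ext x
      rw [expo_apply]
      by_cases hx : ∃ j, i j = x
      · obtain ⟨j, rfl⟩ := hx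
        rw [hval i him, hai]
      · have : a x = 0 := by
          by_contra hne
          rw [← ne_eq, ← hmem, ← hiL, List.mem_ofFn] at hne
          exact hx hne
        rw [this, Finsupp.finsetSum_apply]
        refine Finset.sum_eq_zero fun j _ => Finsupp.single_eq_of_ne fun hj => hx ⟨j, hj.symm⟩
    · intro i' hi' hne
      rw [if_neg]
      intro h'
      refine hne (List.ofFn_injective ?_)
      rw [(hterm i' (Finset.mem_filter.1 hi').2 h').1, hiL]
    · intro hi'
      exact absurd (Finset.mem_filter.2 ⟨Finset.mem_univ _, him⟩) hi'
  · refine Finset.sum_eq_zero fun i hi => if_neg fun h' => h ?_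
    exact (hterm i (Finset.mem_filter.1 hi).2 h').2

theorem coeff_monomialQSym {k : ℕ} (α : Composition k) {l : List ℕ} (hl : l.length ≤ n) :
    coeff (listExpo n l) (monomialQSym n α) =
      if l.filter (fun b => b ≠ 0) = α.blocks then 1 else 0 := by
  have h : List.ofFn (fun i : Fin n => l.getD i 0) = l ++ List.replicate (n - l.length) 0 := by
    apply List.ext_getElem
    · simp; omega
    · intro i h1 h2
      rw [List.getElem_ofFn, List.getElem_append]
      split_ifs with h3
      · exact List.getD_eq_getElem _ _ h3
      · rw [List.getElem_replicate]
        exact List.getD_eq_default _ _ (not_lt.1 h3)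
  rw [listExpo, coeff_monomialQSym_expo, h, List.filter_append]
  simp

open Classical in
theorem coeff_fundamentalQSym {k : ℕ} (α : Composition k) {l : List ℕ} (hl : l.length ≤ n) :
    coeff (listExpo n l) (fundamentalQSym n α) =
      if ∃ L : List (List ℕ), L.flatten = (l.filter fun b => b ≠ 0) ∧ L.map List.sum = α.blocks
      then 1 else 0 := by
  rw [fundamentalQSym, coeff_sum]
  simp only [coeff_monomialQSym _ hl]
  split_ifs with h
  · obtain ⟨L, h1, h2⟩ := h
    have hsum : (l.filter fun b => b ≠ 0).sum = k := by
      rw [← h1, List.sum_flatten, h2, α.blocks_sum]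
    let β : Composition k := ⟨l.filter fun b => b ≠ 0,
      fun h => Nat.pos_of_ne_zero (by simpa using (List.mem_filter.1 h).2), hsum⟩
    rw [Finset.sum_eq_single β, if_pos rfl]
    · intro γ _ hγ
      exact if_neg fun h => hγ (Composition.ext h.symm)
    · intro hβ
      refine absurd (Finset.mem_filter.2 ⟨Finset.mem_univ _, ⟨L, h1, h2⟩, ?_⟩) hβ
      exact (List.length_filter_le _ _).trans hl
  · refine Finset.sum_eq_zero fun β hβ => if_neg fun h' => h ?_
    obtain ⟨L, h1, h2⟩ := (Finset.mem_filter.1 hβ).2.1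
    exact ⟨L, h1.trans h'.symm, h2⟩

/-- The fundamental (if `mg` is `true`) or monomial quasisymmetric polynomial. -/
noncomputable def quasiSym (mg : Bool) (n : ℕ) {k : ℕ} (α : Composition k) :
    MvPolynomial (Fin n) ℂ :=
  if mg then fundamentalQSym n α else monomialQSym n α

theorem coeff_quasiSym (mg : Bool) {k : ℕ} (α : Composition k) {l : List ℕ} (hl : l.length ≤ n) :
    coeff (listExpo n l) (quasiSym mg n α) = ((finTree mg l).leaves.count α.blocks : ℂ) := by
  classical
  cases mg
  · rw [quasiSym, if_neg (by simp), coeff_monomialQSym α hl, finTree_false_leaves,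
      List.count_singleton]
    simp
  · rw [quasiSym, if_pos rfl, coeff_fundamentalQSym α hl,
      count_finTree_true fun h => (α.blocks_pos h).ne rfl]
    simp

/-- The coefficients of a combination of quasisymmetric polynomials, in terms of the coefficients
of the combination, which are given as a function of the sequences of parts. -/
theorem coeff_sum_quasiSym (mg : Bool) (c : StrongComposition n →₀ ℤ) (f : List ℕ → ℤ)
    (hf : ∀ α : StrongComposition n, f α.1.2.blocks = c α) {l : List ℕ} (hl : l.length ≤ n) :
    coeff (listExpo n l) (c.sum fun α a => (a : ℂ) • quasiSym mg n α.1.2) =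
      (((finTree mg l).leaves.map f).sum : ℤ) := by
  classical
  have hsum : ∀ M : List (List ℕ), (∀ y ∈ M, 0 ∉ y ∧ y.length ≤ n) →
      ∑ α ∈ c.support, c α * (M.count α.1.2.blocks : ℤ) = (M.map f).sum := by
    intro M hM
    induction M with
    | nil => simp
    | cons y M ih =>
      obtain ⟨hy0, hyn⟩ := hM y (by simp)
      let β : StrongComposition n := ⟨⟨y.sum, y, fun {b} hb => Nat.pos_of_ne_zero
        (by rintro rfl; exact hy0 hb), rfl⟩, hyn⟩
      have hβ : ∀ α : StrongComposition n, y = α.1.2.blocks ↔ α = β := by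
        rintro ⟨⟨k, ⟨b, hb, hk⟩⟩, hα⟩
        constructor
        · intro h
          simp only at h
          subst hk h
          rfl
        · rintro h
          rw [h]
      simp only [List.count_cons, beq_iff_eq, hβ, Nat.cast_add, mul_add, Finset.sum_add_distrib,
        List.map_cons, List.sum_cons]
      rw [ih fun z hz => hM z (by simp [hz]), add_comm]
      congr 1
      simp only [Nat.cast_ite, Nat.cast_one, Nat.cast_zero, mul_ite, mul_one, mul_zero]
      rw [Finset.sum_ite_eq']
      split_ifs with h
      · exact (hf β).symm
      · rw [← Finsupp.notMem_support_iff.1 h, ← hf β]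
  rw [← hsum _ fun y hy => ⟨(forall_mem_finTree hy).1, (forall_mem_finTree hy).2.trans hl⟩]
  simp only [Finsupp.sum, coeff_sum, coeff_smul, coeff_quasiSym mg _ hl]
  push_cast
  rfl

end QuasiSymmetric

/-! ### Schur coefficients of symmetric polynomials -/

theorem finite_setOf_coeff_shifted_ne_zero {n : ℕ} (P : MvPolynomial (Fin n) ℂ) :
    {lam : PartitionSeq n | P.coeff (expo (shifted lam.1)) ≠ 0}.Finite := by
  refine Set.Finite.of_finite_image (f := fun lam : PartitionSeq n => expo (shifted lam.1))
    (P.support.finite_toSet.subset ?_) ?_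
  · rintro _ ⟨lam, h, rfl⟩
    exact MvPolynomial.mem_support_iff.2 h
  · intro lam _ mu _ h
    refine Subtype.ext (funext fun i => ?_)
    have := congrFun (expo_inj.1 h) i
    simpa [shifted] using this

/-- The coefficients of the product with the Vandermonde product, in terms of the coefficients of
the expansion into quasisymmetric polynomials. -/
theorem coeff_vprod_mul_sum_quasiSym {n : ℕ} (mg : Bool) (c : StrongComposition n →₀ ℤ)
    (f : List ℕ → ℤ) (hf : ∀ α : StrongComposition n, f α.1.2.blocks = c α)
    (lam : PartitionSeq n) :
    MvPolynomial.coeff (expo (shifted lam.1))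
      (vprod n (xvar n) * c.sum fun α a => (a : ℂ) • quasiSym mg n α.1.2) =
      (((coreTree mg ((List.ofFn lam.1).filter fun a => a ≠ 0).reverse).leaves.map fun x =>
        paritySign x.2 * f x.1).sum : ℤ) := by
  have hlen := List.length_filter_le (fun a => decide (a ≠ 0)) (List.ofFn lam.1)
  rw [List.length_ofFn] at hlen
  rw [coeff_vprod_mul, coreTree, BitTree.leaves_bind, List.map_flatMap, List.flatMap_def,
    List.sum_flatten, List.map_map, Int.cast_list_sum, List.map_map]
  refine congrArg List.sum (List.map_congr_left fun x hx => ?_)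
  have hx := length_of_mem_rowsTree hx
  rw [List.length_reverse, List.length_nil, add_zero] at hx
  rw [coeff_sum_quasiSym mg c f hf (hx.trans_le hlen)]
  simp only [Function.comp_apply, BitTree.leaves_map, List.map_map, Function.comp_def,
    List.sum_map_mul_left]
  push_cast
  rfl

/-- The theorem for one of the two families of quasisymmetric polynomials. -/
theorem schurCoeffsInGapP_of_sum_quasiSym (mg : Bool) (A : Set (List Bool)) (n : List Bool → ℕ)
    (G : ∀ w, MvPolynomial (Fin (n w)) ℂ) (hG : ∀ w ∈ A, (G w).IsSymmetric)
    (c : ∀ w, StrongComposition (n w) →₀ ℤ)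
    (hc : CoeffsInGapP A (fun _ α => StrongComposition.word α) c)
    (h : ∀ w ∈ A, G w = (c w).sum fun α a => (a : ℂ) • quasiSym mg (n w) α.1.2) :
    SchurCoeffsInGapP A n G := by
  classical
  obtain ⟨f, hf, hfc⟩ := hc
  obtain ⟨f', hf', hf'f⟩ := inGapP_raise mg hf
  have key : ∀ w ∈ A, ∀ lam : PartitionSeq (n w),
      ((f' (pairWord w (PartitionSeq.word lam)) : ℤ) : ℂ) =
        MvPolynomial.coeff (expo (shifted lam.1)) (vprod (n w) (xvar (n w)) * G w) := by
    intro w hw lam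
    rw [h w hw, coeff_vprod_mul_sum_quasiSym mg (c w) (fun l => f (pairWord w (unaryWord l)))
      (hfc w hw), PartitionSeq.word, hf'f]
    rfl
  have hfin : ∀ w ∈ A, (Function.support fun lam : PartitionSeq (n w) =>
      f' (pairWord w (PartitionSeq.word lam))).Finite := by
    intro w hw
    refine (finite_setOf_coeff_shifted_ne_zero (vprod (n w) (xvar (n w)) * G w)).subset ?_
    intro lam hlam
    rw [Set.mem_ofPred_eq, ← key w hw]
    exact_mod_cast hlam
  let d : ∀ w, PartitionSeq (n w) →₀ ℤ := fun w =>
    if hw : w ∈ A then Finsupp.ofSupportFinite _ (hfin w hw) else 0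
  have hd : ∀ w ∈ A, ∀ lam, d w lam = f' (pairWord w (PartitionSeq.word lam)) := by
    intro w hw lam
    simp only [d, dif_pos hw, Finsupp.ofSupportFinite_coe]
  refine ⟨d, fun w hw d' => ?_, f', hf', fun w hw lam => (hd w hw lam).symm⟩
  rw [eq_sum_schur_iff (hG w hw), DFunLike.ext_iff]
  refine forall_congr' fun lam => ?_
  rw [Finsupp.mapRange_apply, hd w hw, key w hw]

theorem theorem7p1 (A : Set (List Bool)) (n : List Bool → ℕ)
    (G : ∀ w, MvPolynomial (Fin (n w)) ℂ) (hG : ∀ w ∈ A, (G w).IsSymmetric)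
    (c : ∀ w, StrongComposition (n w) →₀ ℤ)
    (hc : CoeffsInGapP A (fun _ α => StrongComposition.word α) c) :
    ((∀ w ∈ A, G w = (c w).sum fun α a => (a : ℂ) • fundamentalQSym (n w) α.1.2) →
      SchurCoeffsInGapP A n G) ∧
    ((∀ w ∈ A, G w = (c w).sum fun α a => (a : ℂ) • monomialQSym (n w) α.1.2) →
      SchurCoeffsInGapP A n G) :=
  ⟨schurCoeffsInGapP_of_sum_quasiSym true A n G hG c hc,
    schurCoeffsInGapP_of_sum_quasiSym false A n G hG c hc⟩
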